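/- Let $r\ge 2$. Let $H=H^*(\mathbf P^r,\mathbf C)=\bigoplus_{a=0}^r\mathbf C\Delta_a$ with $\Delta_a$ the dual class of $\mathbf P^{r-a}$, let $x^0,\dots,x^r$ be the coordinates dual to $(\Delta_a)$, $\partial_a=\partial/\partial x^a$, and let $g_{ab}=g(\partial_a,\partial_b)=\delta_{a+b,r}$ be the Poincaré pairing, with inverse matrix $(g^{ab})$. The $x^a$ are flat coordinates: a formal vector field is flat if its components are constant. A formal series $\Phi\in\mathbf C[[x^0,\dots,x^r]]$ is said to be of Gromov–Witten form if $$\Phi=\frac16\sum_{a+b+c=r}x^ax^bx^c+\sum_{d,\,n_2,\dots,n_r\ge 0}N(d;n_2,\dots,n_r)\,\frac{(x^2)^{n_2}\cdots(x^r)^{n_r}}{n_2!\cdots n_r!}\,e^{dx^1}$$ with $N(d;n_2,\dots,n_r)\in\mathbf C$ such that $N(d;n_2,\dots,n_r)=0$ unless $\sum_{a=2}^r(a-1)n_a=(r+1)d+r-3$ (so that each coefficient of $\Phi$ is a finite sum), and $N(0;n_2,\dots,n_r)=0$ whenever $\sum_a n_a\le 2$ (polynomial terms of degree at most two do not affect third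 derivatives of $\Phi$). The WDVV equations for $\Phi$ are, with $\Phi_{abc}=\partial_a\partial_b\partial_c\Phi$, $$\sum_{e,f}\Phi_{abe}g^{ef}\Phi_{fcd}=\sum_{e,f}\Phi_{bce}g^{ef}\Phi_{fad}\qquad\text{for all }a,b,c,d.$$ The multiplication $\circ$ on formal vector fields is the $\mathbf C[[x]]$-bilinear one with $\partial_a\circ\partial_b=\sum_{c,e}\Phi_{abe}g^{ec}\partial_c$. (i) There is a unique family of numbers $N(d;n_2,\dots,n_r)$ as above with $N(1;0,\dots,0,2)=1$ for which $\Phi$ satisfies the WDVV equations. For this solution $\Phi$: (ii) $e=\partial/\partial x^0$ is a flat identity of $\circ$, i.e. $e$ is flat and $e\circ X=X\circ e=X$ for every formal vector field $X$. (iii) $E=\sum_{a}(1-a)x^a\partial_a+(r+1)\partial_1$ is an Euler field of weight one, i.e. $[E,X\circ Y]-[E,X]\circ Y-X\circ[E,Y]=X\circ Y$ for all formal vector fields $X,Y$, and $[E,X]$ is flat whenever $X$ is flat; moreover $\mathrm{Lie}_E\,g=(2-r)\,g$, i.e. $E(g(X,Y))-g([E,X],Y)-g(X,[E,Y])=(2-r)\,g(X,Y)$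 for all formal vector fields $X,Y$. -/

import Mathlib

namespace QuantumPr

open MvPowerSeries

/-- Formal functions on `H = H^*(P^r, ℂ)`: formal power series in the linear
coordinates `x^0, …, x^r` dual to the basis `Δ_0, …, Δ_r`. -/
abbrev FormalFun (r : ℕ) : Type := MvPowerSeries (Fin (r + 1)) ℂ

/-- The partial derivative `∂_a = ∂/∂x^a`. -/
noncomputable abbrev pd {r : ℕ} (a : Fin (r + 1)) (f : FormalFun r) : FormalFun r :=
  MvPowerSeries.pderiv ℂ a f

/-- The Poincaré pairing `g_{ab} = δ_{a+b,r}`. -/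
def pairing (r : ℕ) : Matrix (Fin (r + 1)) (Fin (r + 1)) ℂ :=
  Matrix.of fun a b => if (a : ℕ) + (b : ℕ) = r then 1 else 0

/-- The inverse matrix `g^{ab}`. -/
noncomputable def pairingInv (r : ℕ) : Matrix (Fin (r + 1)) (Fin (r + 1)) ℂ :=
  (pairing r)⁻¹

/-! ### Gromov–Witten form of the potential -/

/-- Multi-indices `(n_2, …, n_r)`. -/
abbrev MultiIdx (r : ℕ) : Type := {a : Fin (r + 1) // 2 ≤ (a : ℕ)} → ℕ

/-- The multi-index `(0, …, 0, 2)`. -/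
def twoPoints (r : ℕ) : MultiIdx r := fun a => if a.1 = Fin.last r then 2 else 0

/-- `(1/6) (∑ x^a Δ_a)^3`, the cube being evaluated on the fundamental class:
`∫ Δ_a Δ_b Δ_c` is `1` if `a + b + c = r` and `0` otherwise. -/
noncomputable def classicalPart (r : ℕ) : FormalFun r :=
  C (1 / 6 : ℂ) * ∑ a : Fin (r + 1), ∑ b : Fin (r + 1), ∑ c : Fin (r + 1),
    if (a : ℕ) + (b : ℕ) + (c : ℕ) = r then X a * X b * X c else 0

/-- The formal series `e^{d x^1}`. -/
noncomputable def expTerm (r d : ℕ) : FormalFun r :=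
  (PowerSeries.rescale (d : ℂ) (PowerSeries.exp ℂ)).subst (X (1 : Fin (r + 1)) : FormalFun r)

/-- The term `N(d; n) (x^2)^{n_2} ⋯ (x^r)^{n_r} / (n_2! ⋯ n_r!) e^{d x^1}`. -/
noncomputable def gwTerm (r : ℕ) (N : ℕ → MultiIdx r → ℂ) (d : ℕ) (n : MultiIdx r) :
    FormalFun r :=
  C (N d n) * (∏ a, C (((n a).factorial : ℂ)⁻¹) * X a.1 ^ n a) * expTerm r d

/-- The coefficientwise sum of all `gwTerm r N d n`. Each coefficient is a finite sum when
`N` obeys `DimensionConstraint` (see `gwTerm_support_finite`). -/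
noncomputable def gwPart (r : ℕ) (N : ℕ → MultiIdx r → ℂ) : FormalFun r :=
  fun m => ∑ᶠ p : ℕ × MultiIdx r, coeff m (gwTerm r N p.1 p.2)

/-- The potential `Φ` attached to the numbers `N(d; n_2, …, n_r)`. -/
noncomputable def potential (r : ℕ) (N : ℕ → MultiIdx r → ℂ) : FormalFun r :=
  classicalPart r + gwPart r N

/-- `N(d; n)` vanishes unless `∑ (a - 1) n_a = (r + 1) d + r - 3`, i.e. unless finitely many
rational curves of degree `d` are expected to satisfy the incidence conditions. -/
def DimensionConstraint (r : ℕ) (N : ℕ → MultiIdx r → ℂ) : Prop :=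
  ∀ d n, N d n ≠ 0 →
    ∑ a, (((a.1 : ℕ) : ℤ) - 1) * (n a : ℤ) = ((r : ℤ) + 1) * (d : ℤ) + (r : ℤ) - 3

/-- The terms of `Φ` beyond the cubic form contain no polynomial of degree at most two:
such terms do not affect the third derivatives of `Φ`. -/
def NoLowDegreeTerms (r : ℕ) (N : ℕ → MultiIdx r → ℂ) : Prop :=
  ∀ n : MultiIdx r, ∑ a, n a ≤ 2 → N 0 n = 0

/-- The third derivative `Φ_{abc}`. -/
noncomputable def third {r : ℕ} (Φ : FormalFun r) (a b c : Fin (r + 1)) : FormalFun r :=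
  pd a (pd b (pd c Φ))

/-- The WDVV equations. -/
def WDVV {r : ℕ} (Φ : FormalFun r) : Prop :=
  ∀ a b c d : Fin (r + 1),
    ∑ e, ∑ f, third Φ a b e * C (pairingInv r e f) * third Φ f c d =
      ∑ e, ∑ f, third Φ b c e * C (pairingInv r e f) * third Φ f a d

/-- `N` defines a solution of the WDVV equations of Gromov–Witten form with
`N(1; 0, …, 0, 2) = 1`. -/
structure IsGWSolution (r : ℕ) (N : ℕ → MultiIdx r → ℂ) : Prop where
  dimension : DimensionConstraint r N
  noLowDegree : NoLowDegreeTerms r N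
  normalized : N 1 (twoPoints r) = 1
  wdvv : WDVV (potential r N)

/-! ### Formal vector fields -/

/-- The formal vector field `∑ X^a ∂_a`, given by its components `X^a`. -/
abbrev VField (r : ℕ) : Type := Fin (r + 1) → FormalFun r

/-- The coordinate vector field `∂_a`. -/
noncomputable def coordField {r : ℕ} (a : Fin (r + 1)) : VField r := Pi.single a 1

/-- The action of a vector field on functions. -/
noncomputable def act {r : ℕ} (V : VField r) (f : FormalFun r) : FormalFun r :=
  ∑ a, V a * pd a f

/-- The Lie bracket of vector fields. -/
noncomputable def bracket {r : ℕ} (V W : VField r) : VField r :=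
  fun c => act V (W c) - act W (V c)

/-- Flat vector fields (the kernel of `∇`, for which the `x^a` are flat coordinates). -/
def IsFlat {r : ℕ} (V : VField r) : Prop := ∀ a c, pd a (V c) = 0

/-- The multiplication with `∂_a ∘ ∂_b = ∑_c (∑_e Φ_{abe} g^{ec}) ∂_c`. -/
noncomputable def circ {r : ℕ} (Φ : FormalFun r) (V W : VField r) : VField r :=
  fun c => ∑ a, ∑ b, V a * W b * ∑ e, third Φ a b e * C (pairingInv r e c)

/-- The metric `g` on vector fields. -/
noncomputable def metric {r : ℕ} (V W : VField r) : FormalFun r :=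
  ∑ a, ∑ b, C (pairing r a b) * V a * W b

/-- The Poisson tensor `P_U(V, W) = [U, V ∘ W] - [U, V] ∘ W - V ∘ [U, W]`. -/
noncomputable def poissonTensor {r : ℕ} (Φ : FormalFun r) (U V W : VField r) : VField r :=
  bracket U (circ Φ V W) - circ Φ (bracket U V) W - circ Φ V (bracket U W)

/-- `e` is a flat identity of the multiplication `∘`. -/
structure IsFlatIdentity {r : ℕ} (Φ : FormalFun r) (e : VField r) : Prop where
  flat : IsFlat e
  one_circ : ∀ V, circ Φ e V = V
  circ_one : ∀ V, circ Φ V e = V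

/-- `E` is an Euler field of weight `d₀`: `P_E(V, W) = d₀ V ∘ W` and
`[E, Ker ∇] ⊂ Ker ∇`. -/
structure IsEulerField {r : ℕ} (Φ : FormalFun r) (d₀ : ℂ) (E : VField r) : Prop where
  poisson : ∀ V W, poissonTensor Φ E V W = d₀ • circ Φ V W
  preserves_flat : ∀ V, IsFlat V → IsFlat (bracket E V)

/-- The Lie derivative of the metric, `(Lie_E g)(V, W)`. -/
noncomputable def lieMetric {r : ℕ} (E V W : VField r) : FormalFun r :=
  act E (metric V W) - metric (bracket E V) W - metric V (bracket E W)

/-- `E = ∑ (1 - a) x^a ∂_a + (r + 1) ∂_1`. -/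
noncomputable def eulerField (r : ℕ) : VField r :=
  (∑ a : Fin (r + 1), (C (1 - ((a : ℕ) : ℂ)) * X a : FormalFun r) • coordField a) +
    (C ((r : ℂ) + 1) : FormalFun r) • coordField 1

/-! ### The definitions above avoid default values -/

theorem pairing_mul_self (r : ℕ) : pairing r * pairing r = 1 := by
  ext a b
  rw [Matrix.mul_apply, Finset.sum_eq_single (Fin.rev a)]
  · simp only [pairing, Matrix.of_apply, Fin.val_rev, Matrix.one_apply, Fin.ext_iff]
    have := a.2
    have := b.2
    by_cases h : (a : ℕ) = b
    · rw [if_pos (by omega), if_pos (by omega), if_pos h, mul_one]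
    · rw [if_pos (by omega), if_neg (by omega), if_neg h, mul_zero]
  · intro c _ hc
    simp only [pairing, Matrix.of_apply]
    rw [if_neg, zero_mul]
    intro h
    apply hc
    ext
    rw [Fin.val_rev]
    omega
  · simp

theorem pairingInv_eq (r : ℕ) : pairingInv r = pairing r :=
  Matrix.inv_eq_right_inv (pairing_mul_self r)

theorem coeff_expTerm (r d : ℕ) (m : Fin (r + 1) →₀ ℕ) :
    coeff m (expTerm r d) =
      if m = Finsupp.single 1 (m 1) then (d : ℂ) ^ m 1 / (m 1).factorial else 0 := by
  rw [expTerm, PowerSeries.coeff_subst_single]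
  simp [PowerSeries.coeff_rescale, PowerSeries.coeff_exp, div_eq_mul_inv]

theorem of_coeff_gwTerm_ne_zero {r : ℕ} (hr : 1 ≤ r) (N : ℕ → MultiIdx r → ℂ) (d : ℕ)
    (n : MultiIdx r) (m : Fin (r + 1) →₀ ℕ) (h : coeff m (gwTerm r N d n) ≠ 0) :
    N d n ≠ 0 ∧ n = fun a => m a.1 := by
  have hX : ∀ a : {a : Fin (r + 1) // 2 ≤ (a : ℕ)},
      (C (((n a).factorial : ℂ)⁻¹) * X a.1 ^ n a : FormalFun r) =
        monomial (Finsupp.single a.1 (n a)) (((n a).factorial : ℂ)⁻¹) := by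
    intro a
    rw [X_pow_eq, ← monomial_zero_eq_C_apply, monomial_mul_monomial, zero_add, mul_one]
  have hprod : (∏ a, (C (((n a).factorial : ℂ)⁻¹) * X a.1 ^ n a : FormalFun r)) =
      monomial (∑ a, Finsupp.single a.1 (n a)) (∏ a, ((n a).factorial : ℂ)⁻¹) := by
    rw [Finset.prod_congr rfl fun a _ => hX a, prod_monomial]
  rw [gwTerm, hprod, mul_assoc, coeff_C_mul, coeff_monomial_mul, coeff_expTerm] at h
  refine ⟨left_ne_zero_of_mul h, ?_⟩
  have h2 := right_ne_zero_of_mul h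
  split_ifs at h2 with hle hs
  · funext a
    have hk : (∑ b : {b : Fin (r + 1) // 2 ≤ (b : ℕ)}, Finsupp.single b.1 (n b)) a.1 = n a := by
      rw [Finsupp.finsetSum_apply, Finset.sum_eq_single a]
      · simp
      · intro b _ hb
        exact Finsupp.single_eq_of_ne fun e => hb (Subtype.ext e.symm)
      · simp
    have h1 : (1 : Fin (r + 1)) ≠ a.1 := by
      intro e
      have h3 := a.2
      have h4 : ((1 : Fin (r + 1)) : ℕ) = 1 := by
        rw [Fin.val_one', Nat.mod_eq_of_lt (by omega)]
      rw [← e, h4] at h3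
      omega
    have h5 := DFunLike.congr_fun hs a.1
    rw [Finsupp.single_eq_of_ne h1.symm, Finsupp.tsub_apply, hk] at h5
    have h6 := hle a.1
    rw [hk] at h6
    omega
  · simp at h2
  · simp at h2

theorem gwTerm_support_finite {r : ℕ} (hr : 1 ≤ r) (N : ℕ → MultiIdx r → ℂ)
    (hN : DimensionConstraint r N) (m : Fin (r + 1) →₀ ℕ) :
    {p : ℕ × MultiIdx r | coeff m (gwTerm r N p.1 p.2) ≠ 0}.Finite := by
  refine Set.Subsingleton.finite ?_
  rintro ⟨d, n⟩ hp ⟨d', n'⟩ hp'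
  obtain ⟨h1, h2⟩ := of_coeff_gwTerm_ne_zero hr N d n m hp
  obtain ⟨h1', h2'⟩ := of_coeff_gwTerm_ne_zero hr N d' n' m hp'
  have hn : n = n' := h2.trans h2'.symm
  subst hn
  have e1 := hN d n h1
  have e2 := hN d' n h1'
  have e3 : ((r : ℤ) + 1) * ((d : ℤ) - d') = 0 := by linarith
  have e4 : (d : ℤ) = d' := by
    rcases mul_eq_zero.1 e3 with h | h
    · omega
    · omega
  rw [Prod.mk.injEq]
  exact ⟨by exact_mod_cast e4, rfl⟩

end QuantumPr

namespace QuantumPr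

open MvPowerSeries

/-! ### Formal power series: radial integration and the order filtration -/

/-! The potential is reconstructed from the single matrix `U` of multiplication by the Euler field.
Let `D a` be the matrix of multiplication by `∂_a`, and `V` the diagonal grading. Associativity and
commutativity give `[U, D a] = 0`, the unit gives `D a e_0 = e_a`, and homogeneity gives `∂_a U = D
a + [D a, V]` (`IsUnfolding`). At the origin the Euler field is `(r + 1) ∂_1`, and the only quantum
number visible there is the normalized one, so `U(0)` is `r + 1` times the cyclic shift, for which
`e_0` is a cyclic vector. Invertibility of the Krylov matrix persists over formal series, so `D a`
is the unique polynomial in `U` taking `e_0` to `e_a` (`eq_of_commute_of_col`, `multBy`). What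
remains is a closed differential system for `U` with prescribed initial value.

Uniqueness (`IsUnfolding.unique`) is an induction on the order in `x`. For existence, the system is
contracted with `∑ x^a`; the resulting radial equation is solved by a contraction
(`exists_radial_solution`), and integrability (`red_dMat_symm`) recovers the full system
(`exists_unfolding`). The solution is self-adjoint for the pairing (`IsUnfolding.adj_eq`), so
lowering an index gives a symmetric closed tensor, which integrates to a potential
(`exists_third_eq`).

The exponential form has two sources. Homogeneity is a recursion in the exponent of `x^1` which
forces `e^{dx^1}` with `d` rational. Uniqueness makes the solution invariant under a twist by `(r +
1)`-th roots of unity, which makes `d` an integer (`IsUnfolding.dvd_of_coeff_ne_zero`);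
nonnegativity of the weights then gives `d ≥ 0`.

The identity and Euler statements need no reconstruction: they follow from `Φ_{0bc} = g_{bc}` and
from the homogeneity encoded in the dimension constraint. -/

theorem coeff_X_mul_pd {r : ℕ} (a : Fin (r + 1)) (f : FormalFun r) (m : Fin (r + 1) →₀ ℕ) :
    coeff m (X a * pd a f) = (m a : ℂ) * coeff m f := by
  rw [X, coeff_monomial_mul]
  split_ifs with h
  · rw [one_mul, pd, coeff_pderiv, tsub_add_cancel_of_le h, mul_comm]
    have h1 : 1 ≤ m a := by simpa using h a
    congr 1
    rw [Finsupp.tsub_apply, Finsupp.single_eq_same, Nat.cast_sub h1]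
    simp
  · have : m a = 0 := by
      by_contra h0
      refine h (Finsupp.single_le_iff.2 ?_)
      omega
    simp [this]

theorem pd_comm {r : ℕ} (a b : Fin (r + 1)) (f : FormalFun r) :
    pd a (pd b f) = pd b (pd a f) := by
  ext m
  simp only [pd, coeff_pderiv, Finsupp.add_apply, Finsupp.single_apply]
  rw [add_right_comm m]
  by_cases h : a = b
  · subst h; simp
  · simp [h, Ne.symm h]; ring

theorem pd_mul {r : ℕ} (a : Fin (r + 1)) (f g : FormalFun r) :
    pd a (f * g) = f * pd a g + pd a f * g := by
  rw [pd, Derivation.leibniz, smul_eq_mul, smul_eq_mul, mul_comm g]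

theorem pd_sum {r : ℕ} {ι : Type*} (s : Finset ι) (a : Fin (r + 1)) (f : ι → FormalFun r) :
    pd a (∑ i ∈ s, f i) = ∑ i ∈ s, pd a (f i) := map_sum _ _ _

theorem pd_sub {r : ℕ} (a : Fin (r + 1)) (f g : FormalFun r) :
    pd a (f - g) = pd a f - pd a g := map_sub _ _ _

theorem pd_add {r : ℕ} (a : Fin (r + 1)) (f g : FormalFun r) :
    pd a (f + g) = pd a f + pd a g := map_add _ _ _

theorem pd_C {r : ℕ} (a : Fin (r + 1)) (z : ℂ) : pd a (C z : FormalFun r) = 0 := pderiv_C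

theorem pd_C_mul {r : ℕ} (a : Fin (r + 1)) (z : ℂ) (f : FormalFun r) :
    pd a (C z * f) = C z * pd a f := by
  rw [pd_mul, pd_C, zero_mul, add_zero]

theorem pd_X {r : ℕ} (a b : Fin (r + 1)) :
    pd a (X b : FormalFun r) = if a = b then 1 else 0 := by
  split_ifs with h
  · subst h; exact pderiv_X_self
  · exact pderiv_X_of_ne (Ne.symm h)

/-- The radial derivative `∑ x^a ∂_a f`. -/
noncomputable def radial {r : ℕ} (f : FormalFun r) : FormalFun r := ∑ a, X a * pd a f

theorem coeff_radial {r : ℕ} (f : FormalFun r) (m : Fin (r + 1) →₀ ℕ) :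
    coeff m (radial f) = (m.degree : ℂ) * coeff m f := by
  rw [radial, map_sum, Finset.sum_congr rfl fun a _ => coeff_X_mul_pd a f m, ← Finset.sum_mul,
    Finsupp.degree_eq_sum, Nat.cast_sum]

/-- The solution of `radial F = f` with vanishing constant term. -/
noncomputable def radialInt {r : ℕ} (f : FormalFun r) : FormalFun r :=
  fun m => coeff m f / (m.degree : ℂ)

theorem coeff_radialInt {r : ℕ} (f : FormalFun r) (m : Fin (r + 1) →₀ ℕ) :
    coeff m (radialInt f) = coeff m f / (m.degree : ℂ) := rfl

theorem radial_radialInt {r : ℕ} {f : FormalFun r} (hf : coeff 0 f = 0) :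
    radial (radialInt f) = f := by
  ext m
  rw [coeff_radial, coeff_radialInt]
  by_cases h : m = 0
  · subst h; simp [hf]
  · rw [mul_div_cancel₀]
    exact_mod_cast mt (Finsupp.degree_eq_zero_iff m).1 h

theorem coeff_zero_radialInt {r : ℕ} (f : FormalFun r) : coeff 0 (radialInt f) = 0 := by
  rw [coeff_radialInt]; simp

theorem pd_radial {r : ℕ} (a : Fin (r + 1)) (f : FormalFun r) :
    pd a (radial f) = radial (pd a f) + pd a f := by
  simp only [radial, map_sum, pd_mul, Finset.sum_add_distrib, pd_X, ite_mul, one_mul, zero_mul,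
    Finset.sum_ite_eq, Finset.mem_univ, if_true]
  congr 1
  exact Finset.sum_congr rfl fun b _ => by rw [pd_comm]

theorem eq_zero_of_radial_add {r : ℕ} {f : FormalFun r} (h : radial f + f = 0) : f = 0 := by
  ext m
  have := congrArg (coeff m) h
  rw [map_add, coeff_radial, ← add_one_mul, map_zero] at this
  exact (mul_eq_zero.1 this).resolve_left (Nat.cast_add_one_ne_zero _)

/-- A closed formal one-form is exact. -/
theorem exists_primitive {r : ℕ} (ω : Fin (r + 1) → FormalFun r)
    (h : ∀ a b, pd a (ω b) = pd b (ω a)) :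
    ∃ f : FormalFun r, coeff 0 f = 0 ∧ ∀ a, pd a f = ω a := by
  refine ⟨radialInt (∑ b, X b * ω b), coeff_zero_radialInt _, fun a => ?_⟩
  set f := radialInt (∑ b, X b * ω b) with hf
  have h0 : radial f = ∑ b, X b * ω b := by
    refine radial_radialInt ?_
    simp [coeff_zero_X_mul]
  have h1 := pd_radial a f
  rw [h0, pd_sum] at h1
  simp only [pd_mul, Finset.sum_add_distrib, pd_X, ite_mul, one_mul, zero_mul,
    Finset.sum_ite_eq, Finset.mem_univ, if_true, h a] at h1
  refine sub_eq_zero.1 (eq_zero_of_radial_add ?_)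
  have h2 : radial (pd a f - ω a) = radial (pd a f) - ∑ b, X b * pd b (ω a) := by
    simp only [radial, map_sub, mul_sub, Finset.sum_sub_distrib]
  rw [h2]
  linear_combination -h1

/-- The ideal of formal series without terms of degree less than `k`. -/
def highOrder (r k : ℕ) : Ideal (FormalFun r) where
  carrier := {f | ∀ m : Fin (r + 1) →₀ ℕ, m.degree < k → coeff m f = 0}
  add_mem' hf hg m hm := by rw [map_add, hf m hm, hg m hm, add_zero]
  zero_mem' m _ := by simp
  smul_mem' c f hf m hm := by
    rw [smul_eq_mul, coeff_mul]
    refine Finset.sum_eq_zero fun p hp => ?_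
    rw [hf p.2, mul_zero]
    refine lt_of_le_of_lt ?_ hm
    rw [← Finset.HasAntidiagonal.mem_antidiagonal.1 hp, map_add]
    omega

theorem eq_zero_of_mem_highOrder {r : ℕ} {f : FormalFun r} (h : ∀ k, f ∈ highOrder r k) :
    f = 0 := by
  ext m
  exact h (m.degree + 1) m (Nat.lt_succ_self _)

theorem pd_mem_highOrder {r k : ℕ} {f : FormalFun r} (h : f ∈ highOrder r (k + 1))
    (a : Fin (r + 1)) : pd a f ∈ highOrder r k := by
  intro m hm
  rw [pd, coeff_pderiv, h, zero_mul]
  rw [map_add, Finsupp.degree_single]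
  omega

theorem mem_highOrder_succ_of_radial {r k : ℕ} {f : FormalFun r} (h0 : coeff 0 f = 0)
    (h : radial f ∈ highOrder r (k + 1)) : f ∈ highOrder r (k + 1) := by
  intro m hm
  by_cases h1 : m = 0
  · rwa [h1]
  · have := h m hm
    rw [coeff_radial] at this
    refine (mul_eq_zero.1 this).resolve_left ?_
    exact_mod_cast mt (Finsupp.degree_eq_zero_iff m).1 h1

theorem mem_highOrder_of_radial_add {r k : ℕ} {f : FormalFun r}
    (h : radial f + f ∈ highOrder r k) : f ∈ highOrder r k := by
  intro m hm
  have := h m hm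
  rw [map_add, coeff_radial, ← add_one_mul] at this
  exact (mul_eq_zero.1 this).resolve_left (Nat.cast_add_one_ne_zero _)

theorem X_mul_mem_highOrder {r k : ℕ} {f : FormalFun r} (h : f ∈ highOrder r k)
    (a : Fin (r + 1)) : X a * f ∈ highOrder r (k + 1) := by
  intro m hm
  rw [X, coeff_monomial_mul]
  split_ifs with h1
  · rw [h, mul_zero]
    have := congrArg Finsupp.degree (tsub_add_cancel_of_le h1)
    rw [map_add, Finsupp.degree_single] at this
    omega
  · rfl

/-- Since `radial f = ∑ x^a ∂_a f`, integration gains one order. This gain drives the inductions on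
order below. -/
theorem mem_highOrder_succ_of_pd {r k : ℕ} {f : FormalFun r} (h0 : coeff 0 f = 0)
    (h : ∀ a, pd a f ∈ highOrder r k) : f ∈ highOrder r (k + 1) :=
  mem_highOrder_succ_of_radial h0 (Ideal.sum_mem _ fun a _ => X_mul_mem_highOrder (h a) a)

theorem radialInt_mem_highOrder {r k : ℕ} {f : FormalFun r} (h : f ∈ highOrder r k) :
    radialInt f ∈ highOrder r k := by
  intro m hm
  rw [coeff_radialInt, h m hm, zero_div]

theorem radialInt_sub {r : ℕ} (f g : FormalFun r) :
    radialInt (f - g) = radialInt f - radialInt g := by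
  ext m
  simp [coeff_radialInt, sub_div]

/-! ### Matrices of formal power series -/

/-- Square matrices of formal functions indexed like the coordinates. -/
abbrev FMat (r : ℕ) : Type := Matrix (Fin (r + 1)) (Fin (r + 1)) (FormalFun r)

/-- Reduction of a matrix modulo terms of degree at least `k`. -/
noncomputable def red (r k : ℕ) :
    FMat r →+* Matrix (Fin (r + 1)) (Fin (r + 1)) (FormalFun r ⧸ highOrder r k) :=
  (Ideal.Quotient.mk (highOrder r k)).mapMatrix

theorem red_eq_zero {r k : ℕ} {M : FMat r} :
    red r k M = 0 ↔ ∀ i j, M i j ∈ highOrder r k := by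
  rw [← Matrix.ext_iff]
  simp [red, Ideal.Quotient.eq_zero_iff_mem]

theorem red_eq_red {r k : ℕ} {M N : FMat r} :
    red r k M = red r k N ↔ ∀ i j, M i j - N i j ∈ highOrder r k := by
  rw [← sub_eq_zero, ← map_sub, red_eq_zero]
  rfl

theorem red_zero_eq {r : ℕ} (M N : FMat r) : red r 0 M = red r 0 N :=
  red_eq_red.2 fun _ _ _ h => absurd h (Nat.not_lt_zero _)

theorem eq_of_red_eq {r : ℕ} {M N : FMat r} (h : ∀ k, red r k M = red r k N) : M = N := by
  ext1 i j
  exact sub_eq_zero.1 (eq_zero_of_mem_highOrder fun k => red_eq_red.1 (h k) i j)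

/-- The entrywise partial derivative of a matrix. -/
noncomputable def dMat {r : ℕ} (a : Fin (r + 1)) (M : FMat r) : FMat r := fun i j => pd a (M i j)

theorem dMat_mul {r : ℕ} (a : Fin (r + 1)) (M N : FMat r) :
    dMat a (M * N) = M * dMat a N + dMat a M * N := by
  ext1 i j
  simp only [dMat, Matrix.mul_apply, Matrix.add_apply, map_sum, pd_mul, Finset.sum_add_distrib]

theorem dMat_add {r : ℕ} (a : Fin (r + 1)) (M N : FMat r) :
    dMat a (M + N) = dMat a M + dMat a N := by
  ext1 i j
  simp [dMat]

theorem dMat_sub {r : ℕ} (a : Fin (r + 1)) (M N : FMat r) :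
    dMat a (M - N) = dMat a M - dMat a N := by
  ext1 i j
  simp [dMat]

theorem red_succ_eq_of_dMat {r k : ℕ} {M N : FMat r}
    (h0 : ∀ i j, coeff 0 (M i j) = coeff 0 (N i j))
    (h : ∀ a, red r k (dMat a M) = red r k (dMat a N)) :
    red r (k + 1) M = red r (k + 1) N := by
  rw [red_eq_red]
  refine fun i j => mem_highOrder_succ_of_pd ?_ fun a => ?_
  · rw [map_sub, h0, sub_self]
  · rw [pd, map_sub]
    exact red_eq_red.1 (h a) i j

/-- A contracting self-map of the matrices with given constant term has a fixed point. -/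
theorem exists_fixedPoint {r : ℕ} (U₀ : FMat r) (Ψ : FMat r → FMat r)
    (h1 : ∀ U, red r 1 U = red r 1 U₀ → red r 1 (Ψ U) = red r 1 U₀)
    (h2 : ∀ k U U', red r 1 U = red r 1 U₀ → red r 1 U' = red r 1 U₀ →
      red r k U = red r k U' → red r (k + 1) (Ψ U) = red r (k + 1) (Ψ U')) :
    ∃ U, Ψ U = U ∧ red r 1 U = red r 1 U₀ := by
  -- Picard iteration: the terms of degree `n` are stable from the `n`-th iterate on, so the limit
  -- takes each coefficient from the iterate indexed by its degree.
  set u : ℕ → FMat r := fun n => Ψ^[n] U₀ with hu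
  have us : ∀ n, u (n + 1) = Ψ (u n) := fun n => Function.iterate_succ_apply' _ _ _
  have u1 : ∀ n, red r 1 (u n) = red r 1 U₀ := by
    intro n
    induction n with
    | zero => rfl
    | succ n ih => rw [us]; exact h1 _ ih
  have ustep : ∀ n, red r (n + 1) (u (n + 1)) = red r (n + 1) (u n) := by
    intro n
    induction n with
    | zero => rw [zero_add, u1, u1]
    | succ n ih =>
      rw [us (n + 1), us n]
      exact h2 _ _ _ (us n ▸ u1 _) (u1 _) (us n ▸ ih)
  have ucoeff : ∀ (m : Fin (r + 1) →₀ ℕ) (i j) (n : ℕ), m.degree ≤ n →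
      coeff m (u n i j) = coeff m (u m.degree i j) := by
    intro m i j n hn
    induction n, hn using Nat.le_induction with
    | base => rfl
    | succ n hn ih =>
      rw [← ih]
      have := red_eq_red.1 (ustep n) i j m (by omega)
      rwa [map_sub, sub_eq_zero] at this
  set U : FMat r := fun i j m => coeff m (u m.degree i j) with hU
  have hUu : ∀ n, red r (n + 1) U = red r (n + 1) (u n) := by
    intro n
    rw [red_eq_red]
    intro i j m hm
    rw [map_sub, ucoeff m i j n (by omega), sub_eq_zero]
    rfl
  have hU1 : red r 1 U = red r 1 U₀ := hUu 0
  have hk : ∀ k, red r (k + 1) (Ψ U) = red r (k + 1) U := by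
    intro k
    cases k with
    | zero => rw [zero_add, h1 U hU1, hU1]
    | succ k => rw [hUu (k + 1), us, h2 _ _ _ hU1 (u1 k) (hUu k)]
  refine ⟨U, eq_of_red_eq fun k => ?_, hU1⟩
  cases k with
  | zero => exact red_zero_eq _ _
  | succ k => exact hk k

/-! ### Matrices with cyclic vector `e_0` -/

/-- The matrix with columns `e_0, U e_0, U² e_0, …`. -/
def krylov {r : ℕ} {S : Type*} [CommRing S] (U : Matrix (Fin (r + 1)) (Fin (r + 1)) S) :
    Matrix (Fin (r + 1)) (Fin (r + 1)) S := fun i j => (U ^ (j : ℕ)) i 0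

theorem krylov_mapMatrix {r : ℕ} {S T : Type*} [CommRing S] [CommRing T] (f : S →+* T)
    (U : Matrix (Fin (r + 1)) (Fin (r + 1)) S) :
    krylov (f.mapMatrix U) = f.mapMatrix (krylov U) := by
  ext i j
  rw [krylov, ← map_pow]
  rfl

/-- `D` kills `e_0` and commutes with `U`, hence kills every `U^j e_0`; these are the columns of the
invertible matrix `krylov U`. -/
theorem eq_zero_of_commute_of_col {r : ℕ} {S : Type*} [CommRing S]
    {U D : Matrix (Fin (r + 1)) (Fin (r + 1)) S} (hU : IsUnit (krylov U))
    (hD : Commute U D) (h0 : ∀ i, D i 0 = 0) : D = 0 := by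
  have h : D * krylov U = 0 := by
    ext i j
    have h1 : (D * krylov U) i j = (D * U ^ (j : ℕ)) i 0 := by
      simp only [Matrix.mul_apply, krylov]
    rw [h1, ← (hD.pow_left _).eq, Matrix.mul_apply]
    simp [h0]
  exact (hU.mul_left_eq_zero).1 h

theorem eq_of_commute_of_col {r : ℕ} {S : Type*} [CommRing S]
    {U D D' : Matrix (Fin (r + 1)) (Fin (r + 1)) S} (hU : IsUnit (krylov U))
    (hD : Commute U D) (hD' : Commute U D') (h0 : ∀ i, D i 0 = D' i 0) : D = D' :=
  sub_eq_zero.1 <| eq_zero_of_commute_of_col hU (hD.sub_right hD') fun i => by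
    rw [Matrix.sub_apply, h0, sub_self]

/-- The polynomial in `U` that maps `e_0` to `e_a`. -/
noncomputable def multBy {r : ℕ} {S : Type*} [CommRing S]
    (U : Matrix (Fin (r + 1)) (Fin (r + 1)) S) (a : Fin (r + 1)) :
    Matrix (Fin (r + 1)) (Fin (r + 1)) S :=
  ∑ j : Fin (r + 1), (krylov U)⁻¹ j a • U ^ (j : ℕ)

theorem commute_multBy {r : ℕ} {S : Type*} [CommRing S]
    {U D : Matrix (Fin (r + 1)) (Fin (r + 1)) S} (h : Commute D U) (a : Fin (r + 1)) :
    Commute D (multBy U a) :=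
  Commute.sum_right _ _ _ fun _ _ => (h.pow_right _).smul_right _

theorem multBy_col {r : ℕ} {S : Type*} [CommRing S]
    {U : Matrix (Fin (r + 1)) (Fin (r + 1)) S} (hU : IsUnit (krylov U)) (a i : Fin (r + 1)) :
    multBy U a i 0 = if i = a then 1 else 0 := by
  have h : (krylov U * (krylov U)⁻¹) i a = if i = a then 1 else 0 := by
    rw [Matrix.mul_nonsing_inv _ ((Matrix.isUnit_iff_isUnit_det _).1 hU), Matrix.one_apply]
  rw [← h, multBy, Matrix.sum_apply, Matrix.mul_apply]
  exact Finset.sum_congr rfl fun j _ => by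
    rw [Matrix.smul_apply, smul_eq_mul, mul_comm]; rfl

/-! ### The system of differential equations for the Euler multiplication -/

/-- The matrix of multiplication by `(r + 1) Δ_1` in the small quantum cohomology at `q = 1`. -/
def eulerMatZero (r : ℕ) : Matrix (Fin (r + 1)) (Fin (r + 1)) ℂ := fun i j =>
  if (i : ℕ) = j + 1 ∨ ((i : ℕ) = 0 ∧ (j : ℕ) = r) then (r : ℂ) + 1 else 0

/-- The cyclic shift sends `e_j` to `(r + 1) e_{j+1}`; up to the power `r` the wrap-around entry is
never met. -/
theorem eulerMatZero_pow {r : ℕ} (j : ℕ) (hj : j ≤ r) (i : Fin (r + 1)) :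
    (eulerMatZero r ^ j) i 0 = if (i : ℕ) = j then ((r : ℂ) + 1) ^ j else 0 := by
  induction j generalizing i with
  | zero =>
    rw [pow_zero, pow_zero, Matrix.one_apply]
    exact if_congr (by rw [Fin.ext_iff]; rfl) rfl rfl
  | succ j ih =>
    rw [pow_succ', Matrix.mul_apply, Finset.sum_eq_single (⟨j, by omega⟩ : Fin (r + 1))]
    · rw [ih (by omega), if_pos rfl, eulerMatZero]
      have : ¬ ((i : ℕ) = 0 ∧ j = r) := by omega
      simp only [this, or_false]
      split_ifs
      · rw [pow_succ']
      · rw [zero_mul]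
    · intro l _ hl
      rw [ih (by omega), if_neg, mul_zero]
      exact fun h => hl (Fin.ext h)
    · simp

theorem isUnit_krylov_eulerMatZero (r : ℕ) : IsUnit (krylov (eulerMatZero r)) := by
  have h : krylov (eulerMatZero r) =
      Matrix.diagonal fun j : Fin (r + 1) => ((r : ℂ) + 1) ^ (j : ℕ) := by
    ext i j
    rw [krylov, eulerMatZero_pow _ (by omega), Matrix.diagonal_apply]
    simp only [Fin.ext_iff]
    split_ifs with hij
    · rw [hij]
    · rfl
  rw [h, Matrix.isUnit_iff_isUnit_det, Matrix.det_diagonal, isUnit_iff_ne_zero]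
  exact Finset.prod_ne_zero_iff.2 fun j _ => pow_ne_zero _ (Nat.cast_add_one_ne_zero r)

/-- A formal series is invertible as soon as its constant term is; this is applied to the
determinant. -/
theorem isUnit_krylov {r : ℕ} {U : FMat r}
    (h : ∀ i j, coeff 0 (U i j) = eulerMatZero r i j) : IsUnit (krylov U) := by
  have h1 : (constantCoeff (σ := Fin (r + 1)) (R := ℂ)).mapMatrix U = eulerMatZero r := by
    ext i j
    exact h i j
  have h2 := isUnit_krylov_eulerMatZero r
  rw [← h1, krylov_mapMatrix, Matrix.isUnit_iff_isUnit_det, ← RingHom.map_det] at h2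
  rw [Matrix.isUnit_iff_isUnit_det]
  exact isUnit_iff_constantCoeff.2 h2

theorem isUnit_krylov_red {r : ℕ} {U : FMat r} (hU : IsUnit (krylov U)) (k : ℕ) :
    IsUnit (krylov (red r k U)) := by
  rw [red, krylov_mapMatrix]
  exact hU.map _

/-- The grading operator. -/
noncomputable def gradingMat (r : ℕ) : FMat r := Matrix.diagonal fun i => C ((i : ℕ) : ℂ)

theorem dMat_gradingMat {r : ℕ} (a : Fin (r + 1)) : dMat a (gradingMat r) = 0 := by
  ext1 i j
  rw [dMat, gradingMat, Matrix.diagonal_apply]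
  split_ifs
  · rw [pd_C]; rfl
  · simp

/-- `M + [M, V]` with `V` the grading operator. -/
noncomputable def gradedPart {r : ℕ} (M : FMat r) : FMat r :=
  M + (M * gradingMat r - gradingMat r * M)

theorem gradedPart_apply {r : ℕ} (M : FMat r) (i j : Fin (r + 1)) :
    gradedPart M i j = C (1 + ((j : ℕ) : ℂ) - ((i : ℕ) : ℂ)) * M i j := by
  rw [gradedPart, Matrix.add_apply, Matrix.sub_apply, gradingMat, Matrix.mul_diagonal,
    Matrix.diagonal_mul, map_sub, map_add, map_one]
  ring

theorem red_gradedPart {r k : ℕ} {M N : FMat r} (h : red r k M = red r k N) :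
    red r k (gradedPart M) = red r k (gradedPart N) := by
  simp only [gradedPart, map_add, map_sub, map_mul, h]

theorem dMat_gradedPart {r : ℕ} (a : Fin (r + 1)) (M : FMat r) :
    dMat a (gradedPart M) = gradedPart (dMat a M) := by
  simp only [gradedPart, dMat_add, dMat_sub, dMat_mul, dMat_gradingMat, mul_zero, zero_mul,
    zero_add, add_zero]

/-- `U` is the matrix of multiplication by the Euler field and `D a` that of multiplication
by `∂_a`, for the unfolding of the small quantum cohomology at `q = 1`. -/
structure IsUnfolding {r : ℕ} (U : FMat r) (D : Fin (r + 1) → FMat r) : Prop where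
  comm : ∀ a, Commute U (D a)
  col : ∀ a i, D a i 0 = if i = a then 1 else 0
  deriv : ∀ a, dMat a U = gradedPart (D a)
  init : ∀ i j, coeff 0 (U i j) = eulerMatZero r i j

/-- The cyclic-vector argument works over the quotient by `highOrder r k`, so passing from `U` to a
commuting matrix with given first column loses no order. -/
theorem red_eq_red_of_commute {r k : ℕ} {U U' D D' : FMat r} (hU : IsUnit (krylov U))
    (h : red r k U = red r k U') (hD : Commute U D) (hD' : Commute U' D')
    (h0 : ∀ i, D i 0 = D' i 0) : red r k D = red r k D' := by
  refine eq_of_commute_of_col (isUnit_krylov_red hU k) (hD.map (red r k)) ?_ fun i => ?_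
  · rw [h]; exact hD'.map (red r k)
  · exact congrArg (Ideal.Quotient.mk (highOrder r k)) (h0 i)

/-- `U` modulo order `k` determines each `D a` modulo order `k`, hence the derivatives of `U`, hence
`U` modulo order `k + 1`. -/
theorem IsUnfolding.unique {r : ℕ} {U U' : FMat r} {D D' : Fin (r + 1) → FMat r}
    (h : IsUnfolding U D) (h' : IsUnfolding U' D') : U = U' ∧ D = D' := by
  have hU := isUnit_krylov h.init
  have key : ∀ k, red r k U = red r k U' → ∀ a, red r k (D a) = red r k (D' a) :=
    fun k hk a => red_eq_red_of_commute hU hk (h.comm a) (h'.comm a) fun i => by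
      rw [h.col, h'.col]
  have hk : ∀ k, red r k U = red r k U' := by
    intro k
    induction k with
    | zero => exact red_zero_eq _ _
    | succ k ih =>
      refine red_succ_eq_of_dMat (fun i j => by rw [h.init, h'.init]) fun a => ?_
      rw [h.deriv, h'.deriv]
      exact red_gradedPart (key k ih a)
  exact ⟨eq_of_red_eq hk, funext fun a => eq_of_red_eq fun k => key k (hk k) a⟩

theorem dMat_commutator {r : ℕ} {U D : FMat r} (h : Commute U D) (b : Fin (r + 1)) :
    U * dMat b D - dMat b D * U = D * dMat b U - dMat b U * D := by
  have := congrArg (dMat b) h.eq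
  rw [dMat_mul, dMat_mul] at this
  rw [sub_eq_sub_iff_add_eq_add, this]

/-- Up to a given order, the equations for the first derivatives of `U` imply that
`∂_b D_a = ∂_a D_b`. -/
theorem red_dMat_symm {r k : ℕ} {U : FMat r} {D : Fin (r + 1) → FMat r}
    (hU : IsUnit (krylov U)) (hc : ∀ a, Commute U (D a)) (hcc : ∀ a b, Commute (D a) (D b))
    (h0 : ∀ a i, D a i 0 = if i = a then 1 else 0)
    (hk : ∀ a, red r k (dMat a U) = red r k (gradedPart (D a))) (a b : Fin (r + 1)) :
    red r k (dMat b (D a)) = red r k (dMat a (D b)) := by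
  rw [← sub_eq_zero, ← map_sub]
  refine eq_zero_of_commute_of_col (isUnit_krylov_red hU k) ?_ fun i => ?_
  -- Differentiating `[U, D a] = 0` and `[U, D b] = 0` expresses the commutator of `U` with the
  -- defect through the derivatives of `U`.
  · have h1 : U * (dMat b (D a) - dMat a (D b)) - (dMat b (D a) - dMat a (D b)) * U =
        (D a * dMat b U - dMat b U * D a) - (D b * dMat a U - dMat a U * D b) := by
      rw [← dMat_commutator (hc a) b, ← dMat_commutator (hc b) a]
      noncomm_ring
    have h2 := congrArg (red r k) h1
    -- By the Jacobi identity this combination equals `2 [D a, D b] + [[D a, D b], V]`, which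
    -- vanishes. So the defect commutes with `U` modulo order `k`, and its first column is zero
    -- because those of `D a` and `D b` are constant.
    have h3 : D a * gradedPart (D b) - gradedPart (D b) * D a -
        (D b * gradedPart (D a) - gradedPart (D a) * D b) = 0 := by
      have e := (hcc a b).eq
      have e1 : D a * gradedPart (D b) - gradedPart (D b) * D a -
          (D b * gradedPart (D a) - gradedPart (D a) * D b) =
          (D a * D b - D b * D a) + (D a * D b - D b * D a) +
          ((D a * D b - D b * D a) * gradingMat r - gradingMat r * (D a * D b - D b * D a)) := by
        simp only [gradedPart]
        noncomm_ring
      rw [e1, e]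
      simp
    have h4 := congrArg (red r k) h3
    simp only [map_sub, map_mul, map_zero] at h2 h4
    rw [hk a, hk b, h4, sub_eq_zero] at h2
    simpa only [Commute, SemiconjBy, map_sub] using h2
  · have : (dMat b (D a) - dMat a (D b)) i 0 = 0 := by
      rw [Matrix.sub_apply, dMat, dMat, h0, h0]
      split_ifs <;> simp
    exact (congrArg (Ideal.Quotient.mk (highOrder r k)) this).trans (map_zero _)

/-- The contracted equation is a fixed-point problem: `multBy` and `gradedPart` preserve congruences
of order `k`, and the factor `X a` gains the order needed for a contraction. -/
theorem exists_radial_solution (r : ℕ) :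
    ∃ U : FMat r, (∀ i j, coeff 0 (U i j) = eulerMatZero r i j) ∧
      ∀ i j, radial (U i j) = ∑ a, X a * gradedPart (multBy U a) i j := by
  set U₀ : FMat r := fun i j => C (eulerMatZero r i j) with hU₀
  have init : ∀ U : FMat r, red r 1 U = red r 1 U₀ →
      ∀ i j, coeff 0 (U i j) = eulerMatZero r i j := by
    intro U h i j
    have := red_eq_red.1 h i j 0 (by simp)
    rwa [map_sub, sub_eq_zero, coeff_zero_C] at this
  obtain ⟨U, hU, h1⟩ := exists_fixedPoint U₀
    (fun U i j => C (eulerMatZero r i j) +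
      radialInt (∑ a, X a * gradedPart (multBy U a) i j)) (fun U _ => by
      refine red_eq_red.2 fun i j m hm => ?_
      have hm0 : m = 0 := (Finsupp.degree_eq_zero_iff m).1 (by omega)
      rw [hU₀, hm0, map_sub, map_add, coeff_zero_radialInt, add_zero, sub_self])
    (fun k U U' h h' hk => by
      have hu := isUnit_krylov (init U h)
      have hu' := isUnit_krylov (init U' h')
      have hm : ∀ a, red r k (gradedPart (multBy U a)) = red r k (gradedPart (multBy U' a)) :=
        fun a => red_gradedPart <| red_eq_red_of_commute hu hk
          (commute_multBy (Commute.refl U) a) (commute_multBy (Commute.refl U') a) fun i => by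
          rw [multBy_col hu, multBy_col hu']
      refine red_eq_red.2 fun i j => ?_
      rw [add_sub_add_left_eq_sub, ← radialInt_sub, ← Finset.sum_sub_distrib]
      refine radialInt_mem_highOrder (Ideal.sum_mem _ fun a _ => ?_)
      rw [← mul_sub]
      exact X_mul_mem_highOrder (red_eq_red.1 (hm a) i j) a)
  refine ⟨U, init U h1, fun i j => ?_⟩
  have hij := congrFun (congrFun hU i) j
  have h2 : radial (U i j) = radial (C (eulerMatZero r i j) : FormalFun r) +
      radial (radialInt (∑ a, X a * gradedPart (multBy U a) i j)) := by
    conv_lhs => rw [← hij]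
    simp only [radial, pd_add, mul_add, Finset.sum_add_distrib]
  rw [h2, radial_radialInt]
  · simp [radial]
  · simp [coeff_zero_X_mul]

/-- With `G_a = gradedPart (multBy U a)`, the defect `∂_a U - G_a` satisfies `(radial + 1)(∂_a U -
G_a) = ∑ x^b (∂_a G_b - ∂_b G_a)`. If the defects vanish to order `k`, so does the curl by
`red_dMat_symm`, and the factor `x^b` raises the order. -/
theorem exists_unfolding (r : ℕ) : ∃ U : FMat r, IsUnfolding U (multBy U) := by
  obtain ⟨U, init, hrad⟩ := exists_radial_solution r
  have hU := isUnit_krylov init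
  have hc : ∀ a, Commute U (multBy U a) := commute_multBy (Commute.refl U)
  refine ⟨U, hc, multBy_col hU, fun a => ?_, init⟩
  have key : ∀ k, ∀ a, red r k (dMat a U) = red r k (gradedPart (multBy U a)) := by
    intro k
    induction k with
    | zero => exact fun a => red_zero_eq _ _
    | succ k ih =>
      intro a
      rw [red_eq_red]
      intro i j
      apply mem_highOrder_of_radial_add
      have h1 := pd_radial a (U i j)
      rw [hrad, pd_sum] at h1
      simp only [pd_mul, Finset.sum_add_distrib, pd_X, ite_mul, one_mul, zero_mul,
        Finset.sum_ite_eq, Finset.mem_univ, if_true] at h1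
      have h2 : radial (dMat a U i j - gradedPart (multBy U a) i j) +
          (dMat a U i j - gradedPart (multBy U a) i j) =
          ∑ b, X b * (dMat a (gradedPart (multBy U b)) i j -
            dMat b (gradedPart (multBy U a)) i j) := by
        simp only [mul_sub, Finset.sum_sub_distrib, dMat]
        have : radial (pd a (U i j) - gradedPart (multBy U a) i j) =
            radial (pd a (U i j)) - ∑ b, X b * pd b (gradedPart (multBy U a) i j) := by
          simp only [radial, pd_sub, mul_sub, Finset.sum_sub_distrib]
        rw [this]
        linear_combination -h1
      rw [h2]
      refine Ideal.sum_mem _ fun b _ => X_mul_mem_highOrder ?_ b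
      have h3 := red_dMat_symm hU hc (fun a b => commute_multBy (hc a).symm b) (multBy_col hU) ih
      have h4 := red_gradedPart (h3 b a)
      rw [← dMat_gradedPart, ← dMat_gradedPart] at h4
      exact red_eq_red.1 h4 i j
  exact eq_of_red_eq fun k => key k a

/-! ### Consequences of the unfolding equations -/

theorem eulerField_apply {r : ℕ} (c : Fin (r + 1)) :
    eulerField r c = C (1 - ((c : ℕ) : ℂ)) * X c + if c = 1 then C ((r : ℂ) + 1) else 0 := by
  simp only [eulerField, coordField, Pi.add_apply, Finset.sum_apply, Pi.smul_apply, smul_eq_mul,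
    Pi.single_apply, mul_ite, mul_one, mul_zero, Finset.sum_ite_eq, Finset.mem_univ, if_true]

theorem pd_eulerField {r : ℕ} (a c : Fin (r + 1)) :
    pd a (eulerField r c) = if a = c then C (1 - ((c : ℕ) : ℂ)) else 0 := by
  rw [eulerField_apply, pd_add, pd_C_mul, pd_X]
  have : pd a (if c = 1 then C ((r : ℂ) + 1) else 0 : FormalFun r) = 0 := by
    split_ifs
    · exact pd_C _ _
    · exact map_zero _
  rw [this]
  split_ifs <;> simp

theorem coeff_zero_eulerField {r : ℕ} (c : Fin (r + 1)) :
    coeff 0 (eulerField r c) = if c = 1 then (r : ℂ) + 1 else 0 := by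
  rw [eulerField_apply, map_add, coeff_C_mul, coeff_zero_X, mul_zero, zero_add]
  split_ifs
  · exact coeff_zero_C _
  · exact map_zero _

theorem pd_act_eulerField {r : ℕ} (b : Fin (r + 1)) (f : FormalFun r) :
    pd b (act (eulerField r) f) =
      C (1 - ((b : ℕ) : ℂ)) * pd b f + act (eulerField r) (pd b f) := by
  simp only [act, pd_sum, pd_mul, pd_eulerField, Finset.sum_add_distrib, ite_mul, zero_mul,
    Finset.sum_ite_eq, Finset.mem_univ, if_true]
  rw [add_comm]
  congr 1
  exact Finset.sum_congr rfl fun a _ => by rw [pd_comm]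

theorem val_one_eq_one {r : ℕ} (hr : 2 ≤ r) : ((1 : Fin (r + 1)) : ℕ) = 1 := by
  rw [Fin.val_one', Nat.mod_eq_of_lt (by omega)]

namespace IsUnfolding

variable {r : ℕ} {U : FMat r} {D : Fin (r + 1) → FMat r}

theorem isUnit (h : IsUnfolding U D) : IsUnit (krylov U) := isUnit_krylov h.init

theorem eq_multBy (h : IsUnfolding U D) (a : Fin (r + 1)) : D a = multBy U a :=
  eq_of_commute_of_col h.isUnit (h.comm a) (commute_multBy (Commute.refl U) a) fun i => by
    rw [h.col, multBy_col h.isUnit]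

theorem comm_comm (h : IsUnfolding U D) (a b : Fin (r + 1)) : Commute (D a) (D b) := by
  rw [h.eq_multBy b]
  exact commute_multBy (h.comm a).symm b

/-- Both sides are the `i`-th component of `D a D b e_0`. -/
theorem apply_symm (h : IsUnfolding U D) (a b i : Fin (r + 1)) : D a i b = D b i a := by
  have key : ∀ a b, (D a * D b) i 0 = D a i b := fun a b => by
    simp [Matrix.mul_apply, h.col]
  rw [← key a b, ← key b a, (h.comm_comm a b).eq]

theorem zero_eq_one (h : IsUnfolding U D) : D 0 = 1 :=
  eq_of_commute_of_col h.isUnit (h.comm 0) (Commute.one_right U) fun i => by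
    rw [h.col, Matrix.one_apply]

theorem dMat_symm (h : IsUnfolding U D) (a b : Fin (r + 1)) : dMat b (D a) = dMat a (D b) :=
  eq_of_red_eq fun _ => red_dMat_symm h.isUnit h.comm h.comm_comm h.col
    (fun a => by rw [h.deriv]) a b

/-- Both sides commute with `U`, so first columns suffice; `U e_0` and the Euler field have the same
derivatives and the same value at the origin. -/
theorem eq_sum (hr : 2 ≤ r) (h : IsUnfolding U D) : U = ∑ a, eulerField r a • D a := by
  refine eq_of_commute_of_col h.isUnit (Commute.refl U)
    (Commute.sum_right _ _ _ fun a _ => (h.comm a).smul_right _) fun i => ?_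
  have h1 : (∑ a, eulerField r a • D a) i 0 = eulerField r i := by
    simp [Matrix.sum_apply, h.col]
  rw [h1]
  refine pderiv.ext (fun a => ?_) ?_
  · change dMat a U i 0 = pd a _
    rw [h.deriv, gradedPart_apply, h.col, pd_eulerField]
    by_cases hia : a = i
    · subst hia; simp
    · rw [if_neg hia, if_neg (Ne.symm hia), mul_zero]
  · change coeff 0 (U i 0) = coeff 0 (eulerField r i)
    rw [h.init, coeff_zero_eulerField, eulerMatZero]
    have := val_one_eq_one hr
    refine if_congr ?_ rfl rfl
    rw [Fin.ext_iff, this]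
    have h0 : ((0 : Fin (r + 1)) : ℕ) = 0 := rfl
    omega

/-- Differentiate `U = ∑ E^a D a` along `x^b`, replace `∂_b D a` by `∂_a D b`, and compare with the
defining equation for `∂_b U`. -/
theorem act_apply (hr : 2 ≤ r) (h : IsUnfolding U D) (b i j : Fin (r + 1)) :
    act (eulerField r) (D b i j) =
      C (((b : ℕ) : ℂ) + ((j : ℕ) : ℂ) - ((i : ℕ) : ℂ)) * D b i j := by
  have h1 := congrFun (congrFun (h.deriv b) i) j
  have h2 : dMat b U i j = C (1 - ((b : ℕ) : ℂ)) * D b i j + act (eulerField r) (D b i j) := by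
    have e : U i j = ∑ a, eulerField r a * D a i j := by
      conv_lhs => rw [h.eq_sum hr]
      simp [Matrix.sum_apply]
    rw [dMat, e]
    simp only [act, pd_sum, pd_mul, pd_eulerField, Finset.sum_add_distrib, ite_mul, zero_mul,
      Finset.sum_ite_eq, Finset.mem_univ, if_true]
    rw [add_comm]
    congr 1
    exact Finset.sum_congr rfl fun a _ => by
      rw [show pd b (D a i j) = pd a (D b i j) from congrFun (congrFun (h.dMat_symm a b) i) j]
  rw [h2, gradedPart_apply] at h1
  simp only [map_sub, map_add, map_one] at h1 ⊢
  linear_combination h1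

theorem coeff_zero_one (hr : 2 ≤ r) (h : IsUnfolding U D) (i j : Fin (r + 1)) :
    ((r : ℂ) + 1) * coeff 0 (D 1 i j) = eulerMatZero r i j := by
  have e : U i j = ∑ a, eulerField r a * D a i j := by
    conv_lhs => rw [h.eq_sum hr]
    simp [Matrix.sum_apply]
  rw [← h.init, e, map_sum]
  have : ∀ a, coeff 0 (eulerField r a * D a i j) =
      (if a = 1 then (r : ℂ) + 1 else 0) * coeff 0 (D a i j) := fun a => by
    rw [← coeff_zero_eulerField]
    exact map_mul constantCoeff _ _
  simp [this]

end IsUnfolding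

/-! ### Symmetry with respect to the pairing -/

theorem cast_rev {r : ℕ} (i : Fin (r + 1)) : ((i.rev : ℕ) : ℂ) = r - (i : ℕ) := by
  rw [Fin.val_rev, Nat.add_sub_add_right, Nat.cast_sub (by omega)]

/-- The adjoint with respect to the pairing. -/
def adj {r : ℕ} {S : Type*} (M : Matrix (Fin (r + 1)) (Fin (r + 1)) S) :
    Matrix (Fin (r + 1)) (Fin (r + 1)) S := fun i j => M j.rev i.rev

theorem adj_mul {r : ℕ} {S : Type*} [CommRing S]
    (M N : Matrix (Fin (r + 1)) (Fin (r + 1)) S) : adj (M * N) = adj N * adj M := by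
  ext i j
  rw [adj, Matrix.mul_apply, Matrix.mul_apply, ← Equiv.sum_comp Fin.revPerm]
  exact Finset.sum_congr rfl fun l _ => by
    rw [mul_comm]; simp [adj]

theorem adj_pow {r : ℕ} {S : Type*} [CommRing S]
    (M : Matrix (Fin (r + 1)) (Fin (r + 1)) S) (n : ℕ) : adj (M ^ n) = adj M ^ n := by
  induction n with
  | zero =>
    ext i j
    rw [pow_zero, pow_zero, adj, Matrix.one_apply, Matrix.one_apply]
    exact if_congr (by rw [Fin.rev_inj, eq_comm]) rfl rfl
  | succ n ih => rw [pow_succ, adj_mul, ih, pow_succ']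

theorem red_smul {r k : ℕ} (f : FormalFun r) (M : FMat r) :
    red r k (f • M) = Ideal.Quotient.mk (highOrder r k) f • red r k M := by
  ext i j
  exact map_mul (Ideal.Quotient.mk (highOrder r k)) f (M i j)

theorem adj_eq_sum {r : ℕ} {S : Type*} [CommRing S]
    (U : Matrix (Fin (r + 1)) (Fin (r + 1)) S) (a : Fin (r + 1)) :
    adj (multBy U a) = ∑ j : Fin (r + 1), (krylov U)⁻¹ j a • adj U ^ (j : ℕ) := by
  ext i l
  simp only [← adj_pow, adj, multBy, Matrix.sum_apply, Matrix.smul_apply]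

/-- The adjoint of a polynomial in `U` is the same polynomial in `adj U`, with the coefficients
unchanged. -/
theorem red_adj_multBy {r k : ℕ} {U : FMat r} (h : red r k (adj U) = red r k U)
    (a : Fin (r + 1)) : red r k (adj (multBy U a)) = red r k (multBy U a) := by
  rw [adj_eq_sum, multBy, map_sum, map_sum]
  exact Finset.sum_congr rfl fun j _ => by rw [red_smul, red_smul, map_pow, map_pow, h]

theorem adj_gradedPart {r : ℕ} (M : FMat r) : adj (gradedPart M) = gradedPart (adj M) := by
  ext1 i j
  rw [adj, gradedPart_apply, gradedPart_apply, adj]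
  congr 2
  rw [cast_rev, cast_rev]
  ring

/-- The initial matrix is self-adjoint and taking adjoints commutes with `gradedPart`, so
self-adjointness of `U` propagates order by order, and passes to polynomials in `U`. -/
theorem IsUnfolding.adj_eq {r : ℕ} {U : FMat r} {D : Fin (r + 1) → FMat r}
    (h : IsUnfolding U D) (a : Fin (r + 1)) : adj (D a) = D a := by
  have hk : ∀ k, red r k (adj U) = red r k U := by
    intro k
    induction k with
    | zero => exact red_zero_eq _ _
    | succ k ih =>
      refine red_succ_eq_of_dMat (fun i j => ?_) fun a => ?_
      · rw [adj, h.init, h.init]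
        refine if_congr ?_ rfl rfl
        rw [Fin.val_rev, Fin.val_rev]
        omega
      · have : dMat a (adj U) = adj (dMat a U) := rfl
        rw [this, h.deriv, adj_gradedPart, h.eq_multBy]
        exact red_gradedPart (red_adj_multBy ih a)
  rw [h.eq_multBy]
  exact eq_of_red_eq fun k => red_adj_multBy (hk k) a

/-! ### The cyclic symmetry -/

theorem pd_rescale {r : ℕ} (s : Fin (r + 1) → ℂ) (a : Fin (r + 1)) (f : FormalFun r) :
    pd a (rescale s f) = C (s a) * rescale s (pd a f) := by
  ext m
  rw [pd, coeff_pderiv, coeff_rescale, coeff_C_mul, coeff_rescale, coeff_pderiv]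
  rw [Finsupp.prod_add_index' (by simp) (by intros; exact pow_add _ _ _),
    Finsupp.prod_single_index (by simp)]
  ring

theorem rescale_C {r : ℕ} (s : Fin (r + 1) → ℂ) (z : ℂ) :
    rescale s (C z : FormalFun r) = C z := by
  ext m
  rw [coeff_rescale, coeff_C]
  split_ifs with h
  · rw [h]; simp
  · simp

theorem coeff_zero_rescale {r : ℕ} (s : Fin (r + 1) → ℂ) (f : FormalFun r) :
    coeff 0 (rescale s f) = coeff 0 f := by
  rw [coeff_rescale]; simp

/-- The action of a root of unity on the unfolding. -/
theorem IsUnfolding.twist {r : ℕ} {U : FMat r} {D : Fin (r + 1) → FMat r}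
    (h : IsUnfolding U D) {z : ℂ} (hz : z ≠ 0) (hz1 : z ^ (r + 1) = 1) {s : Fin (r + 1) → ℂ}
    (hs : ∀ a, s a = z ^ (((a : ℕ) : ℤ) - 1)) :
    IsUnfolding (Matrix.of fun i j => C (z ^ (((j : ℕ) : ℤ) + 1 - (i : ℕ))) * rescale s (U i j))
      (fun a => Matrix.of fun i j => C (z ^ (((a : ℕ) : ℤ) + (j : ℕ) - (i : ℕ))) * rescale s (D a i j)) where
  comm a := by
    have e := (h.comm a).eq
    ext1 i j
    have e1 := congrArg (rescale s) (congrFun (congrFun e i) j)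
    rw [Matrix.mul_apply, Matrix.mul_apply, map_sum, map_sum] at e1
    have e2 := congrArg (C (z ^ (((a : ℕ) : ℤ) + (j : ℕ) - (i : ℕ) + 1)) * ·) e1
    simp only [Finset.mul_sum, map_mul] at e2
    rw [Matrix.mul_apply, Matrix.mul_apply]
    simp only [Matrix.of_apply]
    convert e2 using 2 with l _ l _
    · rw [mul_mul_mul_comm, ← map_mul C, ← zpow_add₀ hz]
      congr 3
      ring
    · rw [mul_mul_mul_comm, ← map_mul C, ← zpow_add₀ hz]
      congr 3
      ring
  col a i := by
    rw [Matrix.of_apply, h.col]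
    by_cases hia : i = a
    · subst hia
      simp
    · simp [hia]
  deriv a := by
    ext1 i j
    have e := congrFun (congrFun (h.deriv a) i) j
    rw [gradedPart_apply] at e
    rw [gradedPart_apply, dMat, Matrix.of_apply, Matrix.of_apply, pd_C_mul, pd_rescale, ← mul_assoc, ← map_mul C, hs,
      ← zpow_add₀ hz]
    change _ * rescale s (dMat a U i j) = _
    rw [e, map_mul, rescale_C, mul_left_comm]
    congr 4
    ring
  init i j := by
    rw [Matrix.of_apply, coeff_C_mul, coeff_zero_rescale, h.init, eulerMatZero]
    split_ifs with hij
    -- On the entries with `i = j + 1` the exponent is `0`; on the corner entry it is `r + 1`. Only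
    -- the corner needs `z` to be a root of unity.
    · have : z ^ (((j : ℕ) : ℤ) + 1 - (i : ℕ)) = 1 := by
        rcases hij with hij | ⟨hi, hj⟩
        · rw [hij]; simp
        · rw [hi, hj]; simpa using mod_cast hz1
      rw [this, one_mul]
    · rw [mul_zero]

/-- By uniqueness the unfolding equals its twist by a primitive root `z`, so a nonzero coefficient
is fixed by multiplication by `z` to the power of its weight. -/
theorem IsUnfolding.dvd_of_coeff_ne_zero {r : ℕ} {U : FMat r} {D : Fin (r + 1) → FMat r}
    (h : IsUnfolding U D) (a i j : Fin (r + 1)) (m : Fin (r + 1) →₀ ℕ)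
    (hm : coeff m (D a i j) ≠ 0) :
    ((r : ℤ) + 1) ∣ ((a : ℕ) : ℤ) + (j : ℕ) - (i : ℕ) +
      ∑ b : Fin (r + 1), (((b : ℕ) : ℤ) - 1) * (m b : ℤ) := by
  have hp := Complex.isPrimitiveRoot_exp (r + 1) (Nat.succ_ne_zero r)
  set z := Complex.exp (2 * Real.pi * Complex.I / ((r + 1 : ℕ) : ℂ))
  have hz : z ≠ 0 := hp.ne_zero (Nat.succ_ne_zero r)
  have h1 := (h.unique (h.twist hz hp.pow_eq_one
    (s := fun a => z ^ (((a : ℕ) : ℤ) - 1)) fun _ => rfl)).2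
  have h2 := congrArg (coeff m) (congrFun (congrFun (congrFun h1 a) i) j)
  rw [Matrix.of_apply, coeff_C_mul, coeff_rescale, Finsupp.prod_fintype _ _ (by simp)] at h2
  have h3 : ∀ b : Fin (r + 1), (z ^ (((b : ℕ) : ℤ) - 1)) ^ m b =
      z ^ ((((b : ℕ) : ℤ) - 1) * (m b : ℤ)) := fun b => by rw [zpow_mul, zpow_natCast]
  simp only [h3] at h2
  have h4 : ∀ t : Finset (Fin (r + 1)), ∏ b ∈ t, z ^ ((((b : ℕ) : ℤ) - 1) * (m b : ℤ)) =
      z ^ ∑ b ∈ t, (((b : ℕ) : ℤ) - 1) * (m b : ℤ) := by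
    intro t
    induction t using Finset.induction_on with
    | empty => simp
    | insert b t hb ih => rw [Finset.prod_insert hb, Finset.sum_insert hb, zpow_add₀ hz, ih]
  rw [h4, ← mul_assoc, ← zpow_add₀ hz] at h2
  have h5 := mul_right_cancel₀ hm ((one_mul _).trans h2)
  have := (hp.zpow_eq_one_iff_dvd _).1 h5.symm
  exact_mod_cast this

/-! ### The tensor of third derivatives -/

theorem sum_mul_pairingInv {r : ℕ} (f : Fin (r + 1) → FormalFun r) (c : Fin (r + 1)) :
    ∑ e, f e * C (pairingInv r e c) = f c.rev := by
  rw [pairingInv_eq, Finset.sum_eq_single c.rev]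
  · rw [pairing, Matrix.of_apply, if_pos, map_one, mul_one]
    rw [Fin.val_rev]; omega
  · intro e _ he
    rw [pairing, Matrix.of_apply, if_neg, map_zero, mul_zero]
    intro h
    apply he
    ext
    rw [Fin.val_rev]; omega
  · simp

theorem wdvv_iff {r : ℕ} (Φ : FormalFun r) : WDVV Φ ↔ ∀ a b c d : Fin (r + 1),
    ∑ f : Fin (r + 1), third Φ a b f.rev * third Φ f c d =
      ∑ f : Fin (r + 1), third Φ b c f.rev * third Φ f a d := by
  have key : ∀ a b c d, ∑ e, ∑ f, third Φ a b e * C (pairingInv r e f) * third Φ f c d =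
      ∑ f : Fin (r + 1), third Φ a b f.rev * third Φ f c d := by
    intro a b c d
    rw [Finset.sum_comm]
    refine Finset.sum_congr rfl fun f _ => ?_
    rw [← Finset.sum_mul, sum_mul_pairingInv (fun e => third Φ a b e)]
  simp only [WDVV, key]

/-- The properties of the third derivatives of a solution that determine them. -/
structure IsQuantumTensor {r : ℕ} (T : Fin (r + 1) → Fin (r + 1) → Fin (r + 1) → FormalFun r) :
    Prop where
  symm_left : ∀ a b c, T a b c = T b a c
  symm_right : ∀ a b c, T a b c = T a c b
  closed : ∀ a b c d, pd d (T a b c) = pd a (T d b c)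
  unit : ∀ b c, T 0 b c = C (pairing r b c)
  assoc : ∀ a b c d, ∑ f : Fin (r + 1), T a b f.rev * T f c d =
    ∑ f : Fin (r + 1), T b c f.rev * T f a d
  homogeneous : ∀ a b c, act (eulerField r) (T a b c) =
    C (((a : ℕ) : ℂ) + ((b : ℕ) : ℂ) + ((c : ℕ) : ℂ) - r) * T a b c
  coeff_zero : ∀ b c, coeff 0 (T 1 b c) =
    if (b : ℕ) + c + 1 = r ∨ ((b : ℕ) = r ∧ (c : ℕ) = r) then 1 else 0

/-- Reversing the row index lowers it with the pairing. Symmetry in the last two indices is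
self-adjointness of `D a`; associativity is commutativity of the `D a`. -/
theorem IsUnfolding.isQuantumTensor {r : ℕ} (hr : 2 ≤ r) {U : FMat r}
    {D : Fin (r + 1) → FMat r} (h : IsUnfolding U D) :
    IsQuantumTensor fun a b c => D a c.rev b where
  symm_left a b c := h.apply_symm a b _
  symm_right a b c := by
    rw [← congrFun (congrFun (h.adj_eq a) b.rev) c]
    rw [adj, Fin.rev_rev]
  closed a b c d := congrFun (congrFun (h.dMat_symm a d) c.rev) b
  unit b c := by
    rw [h.zero_eq_one, Matrix.one_apply, pairing, Matrix.of_apply]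
    have : c.rev = b ↔ (b : ℕ) + c = r := by
      rw [Fin.ext_iff, Fin.val_rev]; omega
    simp only [this]
    split_ifs <;> simp
  assoc a b c d := by
    have key : ∀ a b c d : Fin (r + 1), ∑ f : Fin (r + 1), D a f.rev.rev b * D f d.rev c =
        (D c * D a) d.rev b := by
      intro a b c d
      rw [Matrix.mul_apply]
      refine Finset.sum_congr rfl fun f _ => ?_
      rw [Fin.rev_rev, h.apply_symm f c, mul_comm]
    have : ∀ f : Fin (r + 1), D b f.rev.rev c = D c f.rev.rev b := fun f => h.apply_symm b c _
    simp only [this]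
    rw [key, key, (h.comm_comm a c).eq]
  homogeneous a b c := by
    rw [h.act_apply hr, cast_rev]
    congr 2
    ring
  coeff_zero b c := by
    have h1 := h.coeff_zero_one hr c.rev b
    have h2 : ((r : ℂ) + 1) ≠ 0 := Nat.cast_add_one_ne_zero r
    rw [← mul_right_inj' h2, h1, eulerMatZero, mul_ite, mul_one, mul_zero]
    refine if_congr ?_ rfl rfl
    rw [Fin.val_rev]
    omega

/-! ### From a tensor back to an unfolding -/

/-- The matrix of multiplication by `∂_a` for the multiplication defined by a tensor. -/
def multMat {r : ℕ} (T : Fin (r + 1) → Fin (r + 1) → Fin (r + 1) → FormalFun r)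
    (a : Fin (r + 1)) : FMat r := Matrix.of fun i j => T a j i.rev

theorem sum_smul_multMat_apply {r : ℕ}
    (T : Fin (r + 1) → Fin (r + 1) → Fin (r + 1) → FormalFun r) (i j : Fin (r + 1)) :
    (∑ a, eulerField r a • multMat T a) i j = ∑ a, eulerField r a * T a j i.rev := by
  rw [Matrix.sum_apply]
  rfl

theorem IsQuantumTensor.isUnfolding {r : ℕ} (hr : 2 ≤ r)
    {T : Fin (r + 1) → Fin (r + 1) → Fin (r + 1) → FormalFun r} (h : IsQuantumTensor T) :
    IsUnfolding (∑ a, eulerField r a • multMat T a) (multMat T) where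
  comm a := by
    refine Commute.sum_left _ _ _ fun b _ => Commute.smul_left ?_ _
    have key : ∀ a b i j, (multMat T a * multMat T b) i j =
        ∑ f : Fin (r + 1), T b j f.rev * T f a i.rev := by
      intro a b i j
      rw [Matrix.mul_apply]
      exact Finset.sum_congr rfl fun f _ => by
        rw [multMat, multMat, Matrix.of_apply, Matrix.of_apply, h.symm_left a f, mul_comm]
    ext1 i j
    rw [key, key, h.assoc b j a]
    exact Finset.sum_congr rfl fun f _ => by rw [h.symm_left j a]
  col a i := by
    rw [multMat, Matrix.of_apply, h.symm_left, h.unit, pairing, Matrix.of_apply]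
    have : (a : ℕ) + i.rev = r ↔ i = a := by
      rw [Fin.ext_iff, Fin.val_rev]; omega
    simp only [this]
    split_ifs <;> simp
  deriv b := by
    ext1 i j
    have e2 := h.homogeneous b j i.rev
    rw [gradedPart_apply, dMat, sum_smul_multMat_apply]
    simp only [pd_sum, pd_mul, pd_eulerField, Finset.sum_add_distrib, ite_mul, zero_mul,
      Finset.sum_ite_eq, Finset.mem_univ, if_true]
    -- Closedness turns `∑ E^a ∂_b T_a` into the action of the Euler field on `T_b`, to which
    -- homogeneity applies.
    rw [Finset.sum_congr rfl fun a _ => by rw [h.closed a j i.rev b]]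
    change act _ _ + _ = _
    rw [e2, cast_rev, ← add_mul, ← map_add C, multMat, Matrix.of_apply]
    congr 2
    ring
  init i j := by
    have e1 : ∀ a, coeff 0 (eulerField r a * T a j i.rev) =
        (if a = 1 then (r : ℂ) + 1 else 0) * coeff 0 (T a j i.rev) := fun a => by
      rw [← coeff_zero_eulerField]
      exact map_mul constantCoeff _ _
    rw [sum_smul_multMat_apply, map_sum]
    simp only [e1, ite_mul, zero_mul, Finset.sum_ite_eq', Finset.mem_univ, if_true]
    rw [h.coeff_zero, eulerMatZero, mul_ite, mul_one, mul_zero]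
    refine if_congr ?_ rfl rfl
    rw [Fin.val_rev]
    omega

theorem IsQuantumTensor.unique {r : ℕ} (hr : 2 ≤ r)
    {T T' : Fin (r + 1) → Fin (r + 1) → Fin (r + 1) → FormalFun r}
    (h : IsQuantumTensor T) (h' : IsQuantumTensor T') : T = T' := by
  have := ((h.isUnfolding hr).unique (h'.isUnfolding hr)).2
  funext a b c
  simpa [multMat] using congrFun (congrFun (congrFun this a) c.rev) b

theorem exists_isQuantumTensor {r : ℕ} (hr : 2 ≤ r) :
    ∃ T : Fin (r + 1) → Fin (r + 1) → Fin (r + 1) → FormalFun r, IsQuantumTensor T ∧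
      ∀ a b c (m : Fin (r + 1) →₀ ℕ), coeff m (T a b c) ≠ 0 →
        ((r : ℤ) + 1) ∣ ((a : ℕ) : ℤ) + (b : ℕ) + (c : ℕ) - r +
          ∑ b : Fin (r + 1), (((b : ℕ) : ℤ) - 1) * (m b : ℤ) := by
  obtain ⟨U, h⟩ := exists_unfolding r
  refine ⟨_, h.isQuantumTensor hr, fun a b c m hm => ?_⟩
  convert h.dvd_of_coeff_ne_zero a c.rev b m hm using 2
  rw [Fin.val_rev]
  omega

/-! ### Third derivatives -/

theorem third_symm_left {r : ℕ} (f : FormalFun r) (a b c : Fin (r + 1)) :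
    third f a b c = third f b a c := pd_comm _ _ _

theorem third_symm_right {r : ℕ} (f : FormalFun r) (a b c : Fin (r + 1)) :
    third f a b c = third f a c b := by
  rw [third, pd_comm b c]; rfl

theorem third_add {r : ℕ} (f g : FormalFun r) (a b c : Fin (r + 1)) :
    third (f + g) a b c = third f a b c + third g a b c := by
  simp only [third, pd_add]

theorem third_sub {r : ℕ} (f g : FormalFun r) (a b c : Fin (r + 1)) :
    third (f - g) a b c = third f a b c - third g a b c := by
  simp only [third, pd_sub]

theorem third_C_mul {r : ℕ} (z : ℂ) (f : FormalFun r) (a b c : Fin (r + 1)) :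
    third (C z * f) a b c = C z * third f a b c := by
  simp only [third, pd_C_mul]

theorem third_closed {r : ℕ} (f : FormalFun r) (a b c d : Fin (r + 1)) :
    pd d (third f a b c) = pd a (third f d b c) := pd_comm _ _ _

theorem coeff_eq_zero_of_pd {r k : ℕ} {f : FormalFun r}
    (h : ∀ a m, k ≤ m.degree → coeff m (pd a f) = 0) (m : Fin (r + 1) →₀ ℕ)
    (hm : k + 1 ≤ m.degree) : coeff m f = 0 := by
  have h0 : coeff m (radial f) = 0 := by
    rw [radial, map_sum]
    refine Finset.sum_eq_zero fun a _ => ?_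
    rw [X, coeff_monomial_mul]
    split_ifs with h1
    · rw [h, mul_zero]
      have := congrArg Finsupp.degree (tsub_add_cancel_of_le h1)
      rw [map_add, Finsupp.degree_single] at this
      omega
    · rfl
  rw [coeff_radial] at h0
  refine (mul_eq_zero.1 h0).resolve_left ?_
  exact_mod_cast (by omega : m.degree ≠ 0)

theorem coeff_pd_eq_zero {r k : ℕ} {f : FormalFun r}
    (h : ∀ m, k + 1 ≤ m.degree → coeff m f = 0) (a : Fin (r + 1)) (m : Fin (r + 1) →₀ ℕ)
    (hm : k ≤ m.degree) : coeff m (pd a f) = 0 := by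
  rw [pd, coeff_pderiv, h, zero_mul]
  rw [map_add, Finsupp.degree_single]
  omega

theorem third_eq_zero_iff {r : ℕ} {f : FormalFun r} :
    (∀ a b c, third f a b c = 0) ↔
      ∀ m : Fin (r + 1) →₀ ℕ, 3 ≤ m.degree → coeff m f = 0 := by
  constructor
  · intro h
    refine coeff_eq_zero_of_pd (k := 2) fun c => coeff_eq_zero_of_pd (k := 1) fun b =>
      coeff_eq_zero_of_pd (k := 0) fun a m _ => ?_
    rw [show pd a (pd b (pd c f)) = 0 from h a b c, map_zero]
  · intro h a b c
    ext m
    exact coeff_pd_eq_zero (coeff_pd_eq_zero (coeff_pd_eq_zero h c) b) a m (Nat.zero_le _)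

theorem third_eq_third_iff {r : ℕ} {f g : FormalFun r} :
    third f = third g ↔
      ∀ m : Fin (r + 1) →₀ ℕ, 3 ≤ m.degree → coeff m f = coeff m g := by
  have := third_eq_zero_iff (f := f - g)
  simp only [third_sub, map_sub, sub_eq_zero] at this
  rw [← this]
  simp only [funext_iff]

theorem act_add {r : ℕ} (V : VField r) (f g : FormalFun r) :
    act V (f + g) = act V f + act V g := by
  simp only [act, pd_add, mul_add, Finset.sum_add_distrib]

theorem act_sum {r : ℕ} {ι : Type*} (s : Finset ι) (V : VField r) (f : ι → FormalFun r) :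
    act V (∑ i ∈ s, f i) = ∑ i ∈ s, act V (f i) := by
  simp only [act, pd_sum, Finset.mul_sum]
  exact Finset.sum_comm

theorem act_mul {r : ℕ} (V : VField r) (f g : FormalFun r) :
    act V (f * g) = f * act V g + act V f * g := by
  simp only [act, pd_mul, mul_add, Finset.sum_add_distrib, Finset.mul_sum, Finset.sum_mul]
  congr 1 <;> exact Finset.sum_congr rfl fun a _ => by ring

theorem act_C {r : ℕ} (V : VField r) (z : ℂ) : act V (C z) = 0 := by
  simp only [act, pd_C, mul_zero, Finset.sum_const_zero]

theorem third_act_eulerField {r : ℕ} (f : FormalFun r) (a b c : Fin (r + 1)) :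
    third (act (eulerField r) f) a b c = act (eulerField r) (third f a b c) +
      C (3 - ((a : ℕ) : ℂ) - ((b : ℕ) : ℂ) - ((c : ℕ) : ℂ)) * third f a b c := by
  simp only [third, pd_act_eulerField, pd_add, pd_C_mul]
  simp only [map_sub, map_one]
  have : (C (3 : ℂ) : FormalFun r) = 1 + 1 + 1 := by
    rw [← map_one C, ← map_add, ← map_add]; norm_num
  rw [this]
  ring

/-- The linear part of the Euler field is diagonal on monomials, while `(r + 1) ∂_1` shifts the
exponent of `x^1`. This makes homogeneity a recursion in that exponent. -/
theorem coeff_act_eulerField {r : ℕ} (f : FormalFun r) (m : Fin (r + 1) →₀ ℕ) :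
    coeff m (act (eulerField r) f) =
      -(((∑ a : Fin (r + 1), (((a : ℕ) : ℤ) - 1) * (m a : ℤ) : ℤ)) : ℂ) * coeff m f +
      ((r : ℂ) + 1) * ((m 1 : ℂ) + 1) * coeff (m + Finsupp.single 1 1) f := by
  have : act (eulerField r) f = (∑ a : Fin (r + 1), C (1 - ((a : ℕ) : ℂ)) * (X a * pd a f)) +
      C ((r : ℂ) + 1) * pd 1 f := by
    simp only [act, eulerField_apply, add_mul, Finset.sum_add_distrib, ite_mul, zero_mul,
      Finset.sum_ite_eq', Finset.mem_univ, if_true, mul_assoc]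
  rw [this, map_add, map_sum, coeff_C_mul, pd, coeff_pderiv]
  simp only [coeff_C_mul, coeff_X_mul_pd]
  simp only [← mul_assoc, ← Finset.sum_mul]
  congr 1
  · congr 1
    push_cast
    rw [← Finset.sum_neg_distrib]
    exact Finset.sum_congr rfl fun a _ => by ring
  · ring

theorem third_classicalPart {r : ℕ} (a b c : Fin (r + 1)) :
    third (classicalPart r) a b c = C (if (a : ℕ) + b + c = r then 1 else 0) := by
  have h : classicalPart r = C (1 / 6 : ℂ) * ∑ i : Fin (r + 1), ∑ j : Fin (r + 1),
      ∑ k : Fin (r + 1), C (if (i : ℕ) + j + k = r then 1 else 0) * (X i * (X j * X k)) := by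
    rw [classicalPart]
    congr 1
    refine Finset.sum_congr rfl fun i _ => Finset.sum_congr rfl fun j _ =>
      Finset.sum_congr rfl fun k _ => ?_
    split_ifs
    · rw [map_one, one_mul, mul_assoc]
    · rw [map_zero, zero_mul]
  rw [h, third_C_mul]
  simp only [third, pd_sum, pd_C, pd_mul, pd_X, pd_add, mul_add,
    Finset.sum_add_distrib, mul_ite, ite_mul, mul_one, one_mul, mul_zero, zero_mul,
    Finset.sum_ite_eq, Finset.mem_univ, if_true, add_zero,
    Finset.sum_const_zero, Finset.sum_ite_irrel]
  have e : ∀ x y z : Fin (r + 1), (a : ℕ) + b + c = x + y + z →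
      (C (if (x : ℕ) + y + z = r then 1 else 0) : FormalFun r) =
        C (if (a : ℕ) + b + c = r then 1 else 0) := fun x y z hx => by rw [hx]
  -- The six orderings of `a, b, c` contribute equally and cancel the factor `1 / 6`.
  rw [e a c b (by ring), e b a c (by ring), e b c a (by ring), e c a b (by ring),
    e c b a (by ring)]
  have h6 : (C (1 / 6 : ℂ) : FormalFun r) * C 6 = 1 := by
    rw [← map_mul, ← map_one C]; norm_num
  have h6' : (C (6 : ℂ) : FormalFun r) = 1 + 1 + 1 + 1 + 1 + 1 := by
    rw [← map_one C]; simp only [← map_add]; norm_num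
  rw [h6'] at h6
  linear_combination (C (if (a : ℕ) + b + c = r then 1 else 0)) * h6

/-! ### Coefficients of a potential of Gromov–Witten form -/

/-- The exponent of the monomial `(x^1)^k (x^2)^{n_2} ⋯ (x^r)^{n_r}`. -/
noncomputable def expo {r : ℕ} (n : MultiIdx r) (k : ℕ) : Fin (r + 1) →₀ ℕ :=
  ∑ a, Finsupp.single a.1 (n a) + Finsupp.single 1 k

theorem sum_single_apply {r : ℕ} (n : MultiIdx r) (b : Fin (r + 1)) :
    (∑ a : {a : Fin (r + 1) // 2 ≤ (a : ℕ)}, Finsupp.single a.1 (n a)) b =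
      if h : 2 ≤ (b : ℕ) then n ⟨b, h⟩ else 0 := by
  rw [Finsupp.finsetSum_apply]
  split_ifs with h
  · rw [Finset.sum_eq_single (⟨b, h⟩ : {a : Fin (r + 1) // 2 ≤ (a : ℕ)})]
    · simp
    · intro c _ hc
      exact Finsupp.single_eq_of_ne fun e => hc (Subtype.ext e.symm)
    · simp
  · refine Finset.sum_eq_zero fun c _ => Finsupp.single_eq_of_ne fun e => h ?_
    rw [e]
    exact c.2

theorem expo_zero {r : ℕ} (hr : 2 ≤ r) (n : MultiIdx r) (k : ℕ) : expo n k 0 = 0 := by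
  have h1 : (0 : Fin (r + 1)) ≠ 1 := by
    rw [Ne, Fin.ext_iff, val_one_eq_one hr]; simp
  rw [expo, Finsupp.add_apply, sum_single_apply, dif_neg (by simp),
    Finsupp.single_eq_of_ne h1, add_zero]

theorem expo_one {r : ℕ} (hr : 2 ≤ r) (n : MultiIdx r) (k : ℕ) : expo n k 1 = k := by
  rw [expo, Finsupp.add_apply, sum_single_apply,
    dif_neg (by rw [val_one_eq_one hr]; omega), Finsupp.single_eq_same, zero_add]

theorem expo_apply {r : ℕ} (hr : 2 ≤ r) (n : MultiIdx r) (k : ℕ)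
    (a : {a : Fin (r + 1) // 2 ≤ (a : ℕ)}) : expo n k a.1 = n a := by
  have h1 : a.1 ≠ 1 := by
    intro h
    have := a.2
    rw [h, val_one_eq_one hr] at this
    omega
  rw [expo, Finsupp.add_apply, sum_single_apply, dif_pos a.2, Finsupp.single_eq_of_ne h1,
    add_zero]

theorem eq_expo {r : ℕ} (hr : 2 ≤ r) {m : Fin (r + 1) →₀ ℕ} (hm : m 0 = 0) :
    m = expo (fun a => m a.1) (m 1) := by
  ext b
  by_cases h0 : b = 0
  · rw [h0, hm, expo_zero hr]
  by_cases h1 : b = 1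
  · rw [h1, expo_one hr]
  · have hb : 2 ≤ (b : ℕ) := by
      rw [Fin.ext_iff] at h0 h1
      rw [val_one_eq_one hr] at h1
      have : ((0 : Fin (r + 1)) : ℕ) = 0 := rfl
      omega
    exact (expo_apply hr (fun a => m a.1) (m 1) ⟨b, hb⟩).symm

theorem degree_expo {r : ℕ} (n : MultiIdx r) (k : ℕ) : (expo n k).degree = ∑ a, n a + k := by
  rw [expo, map_add, map_sum, Finsupp.degree_single]
  simp only [Finsupp.degree_single]

/-- The variable `x^1` has weight zero and `x^0` does not occur. -/
theorem weight_expo {r : ℕ} (hr : 2 ≤ r) (n : MultiIdx r) (k : ℕ) :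
    ∑ b : Fin (r + 1), (((b : ℕ) : ℤ) - 1) * (expo n k b : ℤ) =
      ∑ a, (((a.1 : ℕ) : ℤ) - 1) * (n a : ℤ) := by
  rw [← Finset.sum_filter_add_sum_filter_not Finset.univ (fun b : Fin (r + 1) => 2 ≤ (b : ℕ))]
  have h2 : ∑ b ∈ Finset.univ.filter (fun b : Fin (r + 1) => ¬ 2 ≤ (b : ℕ)),
      (((b : ℕ) : ℤ) - 1) * (expo n k b : ℤ) = 0 := by
    refine Finset.sum_eq_zero fun b hb => ?_
    have hb' := (Finset.mem_filter.1 hb).2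
    by_cases h0 : b = 0
    · rw [h0, expo_zero hr]; simp
    · have : (b : ℕ) = 1 := by
        rw [Fin.ext_iff] at h0
        have : ((0 : Fin (r + 1)) : ℕ) = 0 := rfl
        omega
      rw [this]; simp
  rw [h2, add_zero, Finset.sum_subtype (p := fun b : Fin (r + 1) => 2 ≤ (b : ℕ)) _ (by simp)]
  exact Finset.sum_congr rfl fun a _ => by rw [expo_apply hr]

theorem expo_add_single {r : ℕ} (n : MultiIdx r) (k : ℕ) :
    expo n k + Finsupp.single 1 1 = expo n (k + 1) := by
  rw [expo, expo, add_assoc, ← Finsupp.single_add]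

theorem coeff_gwTerm {r : ℕ} (hr : 2 ≤ r) (N : ℕ → MultiIdx r → ℂ) (d : ℕ) (n : MultiIdx r)
    (m : Fin (r + 1) →₀ ℕ) :
    coeff m (gwTerm r N d n) = if m = expo n (m 1) then
      N d n * (∏ a, ((n a).factorial : ℂ)⁻¹) * ((d : ℂ) ^ m 1 / (m 1).factorial) else 0 := by
  have hX : ∀ a : {a : Fin (r + 1) // 2 ≤ (a : ℕ)},
      (C (((n a).factorial : ℂ)⁻¹) * X a.1 ^ n a : FormalFun r) =
        monomial (Finsupp.single a.1 (n a)) (((n a).factorial : ℂ)⁻¹) := by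
    intro a
    rw [X_pow_eq, ← monomial_zero_eq_C_apply, monomial_mul_monomial, zero_add, mul_one]
  rw [gwTerm, Finset.prod_congr rfl fun a _ => hX a, prod_monomial, mul_assoc, coeff_C_mul,
    coeff_monomial_mul, coeff_expTerm]
  set s := ∑ a : {a : Fin (r + 1) // 2 ≤ (a : ℕ)}, Finsupp.single a.1 (n a) with hs
  have hs1 : s 1 = 0 := by
    rw [hs, sum_single_apply, dif_neg]
    rw [val_one_eq_one hr]; omega
  have h1 : (m - s) 1 = m 1 := by rw [Finsupp.tsub_apply, hs1, Nat.sub_zero]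
  rw [h1, expo, ← hs]
  by_cases h : m = s + Finsupp.single 1 (m 1)
  · have hle : s ≤ m := by
      rw [h]; exact le_self_add
    have hsub : m - s = Finsupp.single 1 (m 1) := by
      conv_lhs => rw [h]
      exact add_tsub_cancel_left _ _
    rw [if_pos hle, if_pos hsub, if_pos h, mul_assoc]
  · rw [if_neg h]
    by_cases hle : s ≤ m
    · rw [if_pos hle, if_neg, mul_zero, mul_zero]
      intro hsub
      apply h
      rw [← hsub, add_tsub_cancel_of_le hle]
    · rw [if_neg hle, mul_zero]

/-- The degree in which `N(·; n)` may be nonzero. -/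
def HasDegree {r : ℕ} (n : MultiIdx r) (d : ℕ) : Prop :=
  ∑ a, (((a.1 : ℕ) : ℤ) - 1) * (n a : ℤ) = ((r : ℤ) + 1) * (d : ℤ) + (r : ℤ) - 3

theorem HasDegree.unique {r : ℕ} {n : MultiIdx r} {d d' : ℕ} (h : HasDegree n d)
    (h' : HasDegree n d') : d = d' := by
  have e3 : ((r : ℤ) + 1) * ((d : ℤ) - d') = 0 := by
    rw [HasDegree] at h h'; linarith
  rcases mul_eq_zero.1 e3 with h | h <;> omega

theorem coeff_gwPart_of_hasDegree {r : ℕ} (hr : 2 ≤ r) {N : ℕ → MultiIdx r → ℂ}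
    (hN : DimensionConstraint r N) {d : ℕ} {n : MultiIdx r} (h : HasDegree n d) (k : ℕ) :
    coeff (expo n k) (gwPart r N) =
      N d n * (∏ a, ((n a).factorial : ℂ)⁻¹) * ((d : ℂ) ^ k / k.factorial) := by
  change ∑ᶠ p : ℕ × MultiIdx r, coeff (expo n k) (gwTerm r N p.1 p.2) = _
  rw [finsum_eq_single _ (d, n)]
  · rw [coeff_gwTerm hr, expo_one hr, if_pos rfl]
  · rintro ⟨d', n'⟩ hp
    by_contra h0
    obtain ⟨h1, h2⟩ := of_coeff_gwTerm_ne_zero (by omega) N d' n' _ h0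
    have h3 : n' = n := h2.trans (funext fun a => expo_apply hr n k a)
    subst h3
    exact hp (by rw [h.unique (hN d' n' h1)])

theorem coeff_gwPart_eq_zero {r : ℕ} (hr : 2 ≤ r) {N : ℕ → MultiIdx r → ℂ}
    (hN : DimensionConstraint r N) {n : MultiIdx r} (h : ∀ d, ¬ HasDegree n d) (k : ℕ) :
    coeff (expo n k) (gwPart r N) = 0 := by
  change ∑ᶠ p : ℕ × MultiIdx r, coeff (expo n k) (gwTerm r N p.1 p.2) = _
  refine finsum_eq_zero_of_forall_eq_zero ?_
  rintro ⟨d', n'⟩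
  by_contra h0
  obtain ⟨h1, h2⟩ := of_coeff_gwTerm_ne_zero (by omega) N d' n' _ h0
  have h3 : n' = n := h2.trans (funext fun a => expo_apply hr n k a)
  subst h3
  exact h d' (hN d' n' h1)

theorem coeff_gwPart_of_ne {r : ℕ} (hr : 2 ≤ r) (N : ℕ → MultiIdx r → ℂ)
    {m : Fin (r + 1) →₀ ℕ} (h : m 0 ≠ 0) : coeff m (gwPart r N) = 0 := by
  change ∑ᶠ p : ℕ × MultiIdx r, coeff m (gwTerm r N p.1 p.2) = _
  refine finsum_eq_zero_of_forall_eq_zero fun p => ?_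
  rw [coeff_gwTerm hr, if_neg]
  intro e
  rw [e, expo_zero hr] at h
  exact h rfl

theorem pd_zero_gwPart {r : ℕ} (hr : 2 ≤ r) (N : ℕ → MultiIdx r → ℂ) :
    pd 0 (gwPart r N) = 0 := by
  ext m
  rw [pd, coeff_pderiv, coeff_gwPart_of_ne hr, zero_mul, map_zero]
  simp

/-- On a term of degree `d` the eigenvalue is `(r + 1) d - ∑ (a - 1) n_a`, which the dimension
constraint sets to `3 - r`. -/
theorem act_eulerField_gwPart {r : ℕ} (hr : 2 ≤ r) {N : ℕ → MultiIdx r → ℂ}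
    (hN : DimensionConstraint r N) :
    act (eulerField r) (gwPart r N) = C (3 - (r : ℂ)) * gwPart r N := by
  ext m
  rw [coeff_act_eulerField, coeff_C_mul]
  by_cases hm : m 0 = 0
  · obtain ⟨n, k, rfl⟩ : ∃ n k, m = expo n k := ⟨_, _, eq_expo hr hm⟩
    rw [weight_expo hr, expo_add_single, expo_one hr]
    by_cases h : ∃ d, HasDegree n d
    · obtain ⟨d, h⟩ := h
      rw [coeff_gwPart_of_hasDegree hr hN h, coeff_gwPart_of_hasDegree hr hN h, h]
      have hk : (k : ℂ) + 1 ≠ 0 := Nat.cast_add_one_ne_zero k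
      have hk' : (k.factorial : ℂ) ≠ 0 := Nat.cast_ne_zero.2 k.factorial_ne_zero
      rw [Nat.factorial_succ, pow_succ]
      push_cast
      field_simp
      ring
    · push Not at h
      rw [coeff_gwPart_eq_zero hr hN h, coeff_gwPart_eq_zero hr hN h, mul_zero, mul_zero,
        mul_zero, add_zero]
  · rw [coeff_gwPart_of_ne hr _ hm, coeff_gwPart_of_ne hr, mul_zero, mul_zero, mul_zero,
      add_zero]
    simp [hm]

/-- Terms with `d = 0` do not involve `x^1`, so differentiation along `x^1` leaves only `d ≥ 1`. -/
theorem coeff_pd_one_gwPart {r : ℕ} (hr : 2 ≤ r) {N : ℕ → MultiIdx r → ℂ}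
    (hN : DimensionConstraint r N) {m : Fin (r + 1) →₀ ℕ}
    (h : coeff m (pd 1 (gwPart r N)) ≠ 0) :
    ∃ d : ℕ, 1 ≤ d ∧ m 0 = 0 ∧ ∑ b : Fin (r + 1), (((b : ℕ) : ℤ) - 1) * (m b : ℤ) =
      ((r : ℤ) + 1) * (d : ℤ) + (r : ℤ) - 3 := by
  rw [pd, coeff_pderiv] at h
  have h := left_ne_zero_of_mul h
  by_cases hm : m 0 = 0
  · obtain ⟨n, k, rfl⟩ : ∃ n k, m = expo n k := ⟨_, _, eq_expo hr hm⟩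
    rw [expo_add_single] at h
    by_cases hd : ∃ d, HasDegree n d
    · obtain ⟨d, hd⟩ := hd
      refine ⟨d, ?_, hm, by rw [weight_expo hr]; exact hd⟩
      rw [coeff_gwPart_of_hasDegree hr hN hd] at h
      by_contra h0
      have : d = 0 := by omega
      subst this
      simp at h
    · push Not at hd
      exact absurd (coeff_gwPart_eq_zero hr hN hd _) h
  · refine absurd (coeff_gwPart_of_ne hr N ?_) h
    simp [hm]

theorem hasDegree_twoPoints {r : ℕ} (hr : 2 ≤ r) : HasDegree (twoPoints r) 1 := by
  rw [HasDegree, Finset.sum_eq_single ⟨Fin.last r, by rw [Fin.val_last]; omega⟩]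
  · simp only [twoPoints, if_true, Fin.val_last]
    push_cast
    ring
  · intro b _ hb
    rw [twoPoints, if_neg fun h => hb (Subtype.ext h)]
    simp
  · simp

theorem prod_factorial_twoPoints {r : ℕ} (hr : 2 ≤ r) :
    ∏ a, ((twoPoints r a).factorial : ℂ)⁻¹ = 1 / 2 := by
  rw [Finset.prod_eq_single ⟨Fin.last r, by rw [Fin.val_last]; omega⟩]
  · simp [twoPoints]
  · intro b _ hb
    rw [twoPoints, if_neg fun h => hb (Subtype.ext h)]
    simp
  · simp

theorem expo_twoPoints {r : ℕ} (hr : 2 ≤ r) (k : ℕ) :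
    expo (twoPoints r) k = Finsupp.single (Fin.last r) 2 + Finsupp.single 1 k := by
  rw [expo, Finset.sum_eq_single ⟨Fin.last r, by rw [Fin.val_last]; omega⟩]
  · simp [twoPoints]
  · intro b _ hb
    rw [twoPoints, if_neg fun h => hb (Subtype.ext h)]
    simp
  · simp

theorem weight_single_add_single {r : ℕ} (b c : Fin (r + 1)) :
    ∑ i : Fin (r + 1), (((i : ℕ) : ℤ) - 1) *
      (((Finsupp.single b 1 + Finsupp.single c 1 : Fin (r + 1) →₀ ℕ) i : ℕ) : ℤ) =
      (b : ℕ) + (c : ℕ) - 2 := by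
  simp only [Finsupp.add_apply, Finsupp.single_apply, Nat.cast_add, Nat.cast_ite, Nat.cast_one,
    Nat.cast_zero, mul_add, mul_ite, mul_one, mul_zero, Finset.sum_add_distrib,
    Finset.sum_ite_eq, Finset.mem_univ, if_true]
  ring

theorem coeff_zero_third_one {r : ℕ} (f : FormalFun r) (b c : Fin (r + 1)) :
    coeff 0 (third f 1 b c) = coeff (Finsupp.single b 1 + Finsupp.single c 1) (pd 1 f) *
      (((Finsupp.single b 1 : Fin (r + 1) →₀ ℕ) c : ℂ) + 1) := by
  rw [third_symm_left, third_symm_right, third, pd, coeff_pderiv, zero_add, pd, coeff_pderiv]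
  simp

/-- A contribution of degree `d ≥ 1` needs `b + c - 2 = (r + 1) d + r - 3 ≥ 2r - 2`, hence `b = c =
r` and only the normalized number enters. -/
theorem coeff_zero_third_gwPart {r : ℕ} (hr : 2 ≤ r) {N : ℕ → MultiIdx r → ℂ}
    (hN : DimensionConstraint r N) (h1 : N 1 (twoPoints r) = 1) (b c : Fin (r + 1)) :
    coeff 0 (third (gwPart r N) 1 b c) = if (b : ℕ) = r ∧ (c : ℕ) = r then 1 else 0 := by
  rw [coeff_zero_third_one]
  split_ifs with hbc
  · have hb : b = Fin.last r := Fin.ext hbc.1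
    have hc : c = Fin.last r := Fin.ext hbc.2
    have hl : (1 : Fin (r + 1)) ≠ Fin.last r := by
      rw [Ne, Fin.ext_iff, val_one_eq_one hr, Fin.val_last]; omega
    rw [hb, hc, pd, coeff_pderiv, ← Finsupp.single_add]
    have := coeff_gwPart_of_hasDegree hr hN (hasDegree_twoPoints hr) 1
    rw [expo_twoPoints hr, h1, prod_factorial_twoPoints hr] at this
    rw [this]
    simp [hl]
    norm_num
  · by_contra h
    obtain ⟨d, hd, -, hw⟩ := coeff_pd_one_gwPart hr hN (left_ne_zero_of_mul h)
    rw [weight_single_add_single] at hw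
    apply hbc
    have : (1 : ℤ) ≤ d := by exact_mod_cast hd
    have h3 : (0 : ℤ) ≤ ((r : ℤ) + 1) * (d - 1) := mul_nonneg (by omega) (by omega)
    have h4 : ((r : ℤ) + 1) * (d - 1) = ((r : ℤ) + 1) * d - (r + 1) := by ring
    constructor <;> omega

/-! ### A Gromov–Witten solution gives a quantum tensor -/

theorem third_potential_zero {r : ℕ} (hr : 2 ≤ r) (N : ℕ → MultiIdx r → ℂ) (b c : Fin (r + 1)) :
    third (potential r N) 0 b c = C (pairing r b c) := by
  rw [potential, third_add, third_classicalPart]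
  have : third (gwPart r N) 0 b c = 0 := by
    rw [third_symm_left, third_symm_right, third, pd_zero_gwPart hr,
      show pd c (0 : FormalFun r) = 0 from map_zero _]
    exact map_zero _
  rw [this, add_zero, pairing, Matrix.of_apply]
  congr 1
  exact if_congr (by rw [Fin.val_zero, zero_add]) rfl rfl

theorem C_mul_C_ite_eq_zero {r : ℕ} (a b c : Fin (r + 1)) :
    (C (((a : ℕ) : ℂ) + ((b : ℕ) : ℂ) + ((c : ℕ) : ℂ) - r) *
      C (if (a : ℕ) + b + c = r then 1 else 0) : FormalFun r) = 0 := by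
  split_ifs with h
  · have : ((a : ℕ) : ℂ) + ((b : ℕ) : ℂ) + ((c : ℕ) : ℂ) = r := by exact_mod_cast h
    rw [this, sub_self, map_zero, zero_mul]
  · simp

theorem third_potential_homogeneous {r : ℕ} (hr : 2 ≤ r) {N : ℕ → MultiIdx r → ℂ}
    (hN : DimensionConstraint r N) (a b c : Fin (r + 1)) :
    act (eulerField r) (third (potential r N) a b c) =
      C (((a : ℕ) : ℂ) + ((b : ℕ) : ℂ) + ((c : ℕ) : ℂ) - r) * third (potential r N) a b c := by
  have h1 := third_act_eulerField (gwPart r N) a b c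
  rw [act_eulerField_gwPart hr hN, third_C_mul] at h1
  rw [potential, third_add, third_classicalPart, act_add, act_C, zero_add, mul_add]
  rw [C_mul_C_ite_eq_zero]
  simp only [map_sub, map_add] at h1 ⊢
  linear_combination -h1

theorem IsGWSolution.isQuantumTensor {r : ℕ} (hr : 2 ≤ r) {N : ℕ → MultiIdx r → ℂ}
    (h : IsGWSolution r N) : IsQuantumTensor (third (potential r N)) where
  symm_left := third_symm_left _
  symm_right := third_symm_right _
  closed := third_closed _
  unit := third_potential_zero hr N
  assoc := (wdvv_iff _).1 h.wdvv
  homogeneous := third_potential_homogeneous hr h.dimension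
  coeff_zero b c := by
    rw [potential, third_add, third_classicalPart, map_add, coeff_zero_C,
      coeff_zero_third_gwPart hr h.dimension h.normalized, val_one_eq_one hr]
    by_cases h1 : (b : ℕ) + c + 1 = r
    · rw [if_pos (by omega), if_neg (by omega), if_pos (Or.inl h1), add_zero]
    · rw [if_neg (by omega), zero_add]
      simp [h1]

/-- Third derivatives see exactly the coefficients of total degree at least three. For `d > 0` the
factor `(x^1)^3` brings any `n` into this range; for `d = 0` the remaining numbers vanish by
convention. -/
theorem IsGWSolution.unique {r : ℕ} (hr : 2 ≤ r) {N N' : ℕ → MultiIdx r → ℂ}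
    (h : IsGWSolution r N) (h' : IsGWSolution r N') : N = N' := by
  have e := third_eq_third_iff.1 ((h.isQuantumTensor hr).unique hr (h'.isQuantumTensor hr))
  simp only [potential, map_add, add_right_inj] at e
  funext d n
  by_cases hd : HasDegree n d
  · have key : ∀ k, 3 ≤ ∑ a, n a + k → (d : ℂ) ^ k ≠ 0 → N d n = N' d n := by
      intro k hk hdk
      have := e (expo n k) (by rwa [degree_expo])
      rw [coeff_gwPart_of_hasDegree hr h.dimension hd,
        coeff_gwPart_of_hasDegree hr h'.dimension hd] at this
      refine mul_right_cancel₀ ?_ (mul_right_cancel₀ ?_ this)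
      · exact Finset.prod_ne_zero_iff.2 fun a _ =>
          inv_ne_zero (Nat.cast_ne_zero.2 (Nat.factorial_ne_zero _))
      · exact div_ne_zero hdk (Nat.cast_ne_zero.2 (Nat.factorial_ne_zero _))
    by_cases hd0 : d = 0
    · subst hd0
      by_cases hn : ∑ a, n a ≤ 2
      · rw [h.noLowDegree n hn, h'.noLowDegree n hn]
      · exact key 0 (by omega) (by simp)
    · exact key 3 (by omega) (pow_ne_zero _ (Nat.cast_ne_zero.2 hd0))
  · rw [not_imp_comm.1 (h.dimension d n) hd, not_imp_comm.1 (h'.dimension d n) hd]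

/-! ### Construction of the Gromov–Witten solution -/

/-- A symmetric closed tensor is the tensor of third derivatives of a formal series. -/
theorem exists_third_eq {r : ℕ} (S : Fin (r + 1) → Fin (r + 1) → Fin (r + 1) → FormalFun r)
    (hl : ∀ a b c, S a b c = S b a c) (hr : ∀ a b c, S a b c = S a c b)
    (hc : ∀ a b c d, pd d (S a b c) = pd a (S d b c)) :
    ∃ φ ∈ highOrder r 3, ∀ a b c, third φ a b c = S a b c := by
  have h1 : ∀ b c, ∃ f : FormalFun r, coeff 0 f = 0 ∧ ∀ a, pd a f = S a b c := fun b c =>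
    exists_primitive _ fun a d => hc d b c a
  choose F hF0 hF using h1
  have h2 : ∀ c, ∃ f : FormalFun r, coeff 0 f = 0 ∧ ∀ b, pd b f = F b c := fun c =>
    exists_primitive _ fun a b => by rw [hF, hF, hl]
  choose G hG0 hG using h2
  -- Primitives normalized to have no constant term inherit the symmetry of `S`, which makes the
  -- next one-form closed.
  have hFs : ∀ b c, F b c = F c b := fun b c =>
    pderiv.ext (fun a => (hF b c a).trans ((hr a b c).trans (hF c b a).symm))
      ((hF0 b c).trans (hF0 c b).symm)
  obtain ⟨φ, hφ0, hφ⟩ := exists_primitive G fun a b => by rw [hG, hG, hFs]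
  refine ⟨φ, ?_, fun a b c => by rw [third, hφ, hG, hF]⟩
  refine mem_highOrder_succ_of_pd hφ0 fun c => ?_
  rw [hφ]
  refine mem_highOrder_succ_of_pd (hG0 c) fun b => ?_
  rw [hG]
  intro m hm
  rw [(Finsupp.degree_eq_zero_iff m).1 (by omega), hF0]

theorem exists_eq_add_single {r k : ℕ} {m : Fin (r + 1) →₀ ℕ} (h : k + 1 ≤ m.degree) :
    ∃ a m', m = m' + Finsupp.single a 1 ∧ k ≤ Finsupp.degree m' := by
  have h0 : m ≠ 0 := by
    rintro rfl
    simp at h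
  obtain ⟨a, ha⟩ := Finsupp.ne_iff.1 h0
  have hle : Finsupp.single a 1 ≤ m := Finsupp.single_le_iff.2 (Nat.one_le_iff_ne_zero.2 ha)
  refine ⟨a, m - Finsupp.single a 1, (tsub_add_cancel_of_le hle).symm, ?_⟩
  have := congrArg Finsupp.degree (tsub_add_cancel_of_le hle)
  rw [map_add, Finsupp.degree_single] at this
  omega

theorem weight_add_single {r : ℕ} (m : Fin (r + 1) →₀ ℕ) (a : Fin (r + 1)) :
    ∑ i : Fin (r + 1), (((i : ℕ) : ℤ) - 1) * (((m + Finsupp.single a 1 : Fin (r + 1) →₀ ℕ) i : ℕ) : ℤ) =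
      ∑ i : Fin (r + 1), (((i : ℕ) : ℤ) - 1) * (m i : ℤ) + ((a : ℕ) - 1) := by
  simp only [Finsupp.add_apply, Finsupp.single_apply, Nat.cast_add, Nat.cast_ite, Nat.cast_one,
    Nat.cast_zero, mul_add, mul_ite, mul_one, mul_zero, Finset.sum_add_distrib,
    Finset.sum_ite_eq, Finset.mem_univ, if_true]

/-- The part beyond the classical cubic form of the potential of the quantum cohomology. -/
structure IsQuantumCorrection {r : ℕ} (φ : FormalFun r) : Prop where
  mem : φ ∈ highOrder r 3
  isQuantumTensor : IsQuantumTensor (third (classicalPart r + φ))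
  dvd : ∀ m : Fin (r + 1) →₀ ℕ, 3 ≤ m.degree → coeff m φ ≠ 0 →
    ((r : ℤ) + 1) ∣ ∑ b : Fin (r + 1), (((b : ℕ) : ℤ) - 1) * (m b : ℤ) + 3 - r

theorem exists_isQuantumCorrection {r : ℕ} (hr : 2 ≤ r) :
    ∃ φ : FormalFun r, IsQuantumCorrection φ := by
  obtain ⟨T, hT, hdvd⟩ := exists_isQuantumTensor hr
  obtain ⟨φ, hφ, h3⟩ := exists_third_eq (fun a b c => T a b c - third (classicalPart r) a b c)
    (fun a b c => by rw [hT.symm_left, third_symm_left])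
    (fun a b c => by rw [hT.symm_right, third_symm_right])
    (fun a b c d => by rw [pd_sub, pd_sub, hT.closed, third_closed])
  have hsum : third (classicalPart r + φ) = T := by
    funext a b c
    rw [third_add, h3]
    ring
  refine ⟨φ, hφ, by rwa [hsum], fun m hm h => ?_⟩
  obtain ⟨c, m, rfl, hm2⟩ := exists_eq_add_single (k := 2) hm
  obtain ⟨b, m, rfl, hm1⟩ := exists_eq_add_single (k := 1) hm2
  obtain ⟨a, m, rfl, -⟩ := exists_eq_add_single (k := 0) hm1
  have h4 : coeff m (third φ a b c) ≠ 0 := by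
    rw [third, pd, coeff_pderiv, pd, coeff_pderiv, pd, coeff_pderiv]
    exact mul_ne_zero (mul_ne_zero (mul_ne_zero h (Nat.cast_add_one_ne_zero _))
      (Nat.cast_add_one_ne_zero _)) (Nat.cast_add_one_ne_zero _)
  simp only [weight_add_single]
  -- If `T` does not contribute, the coefficient comes from the constant classical tensor, whose
  -- weight is `0`.
  by_cases h5 : coeff m (T a b c) = 0
  · rw [h3, map_sub, h5, zero_sub, third_classicalPart, neg_ne_zero, coeff_C] at h4
    split_ifs at h4 with hm0 habc
    · rw [hm0]
      simp only [Finsupp.coe_zero, Pi.zero_apply, Nat.cast_zero, mul_zero, Finset.sum_const_zero]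
      have : (0 : ℤ) + ((a : ℕ) - 1) + ((b : ℕ) - 1) + ((c : ℕ) - 1) + 3 - r = 0 := by omega
      rw [this]
      exact dvd_zero _
    · exact absurd rfl h4
    · exact absurd rfl h4
  · convert hdvd a b c m h5 using 1
    ring

namespace IsQuantumCorrection

variable {r : ℕ} {φ : FormalFun r}

theorem pd_zero (h : IsQuantumCorrection φ) : pd 0 φ = 0 := by
  have h3 : ∀ a b, third φ a b 0 = 0 := fun a b => by
    have := h.isQuantumTensor.unit a b
    rw [third_add, third_classicalPart, pairing, Matrix.of_apply, Fin.val_zero,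
      zero_add] at this
    rw [third_symm_right, third_symm_left]
    exact add_eq_left.1 this
  have h2 := pd_mem_highOrder h.mem 0
  have h4 : ∀ b, pd b (pd 0 φ) = 0 := fun b =>
    pderiv.ext (fun a => (h3 a b).trans (map_zero _).symm)
      ((pd_mem_highOrder h2 b 0 (by simp)).trans (map_zero _).symm)
  exact pderiv.ext (fun b => (h4 b).trans (map_zero _).symm)
    ((h2 0 (by simp)).trans (map_zero _).symm)

theorem coeff_of_ne (h : IsQuantumCorrection φ) {m : Fin (r + 1) →₀ ℕ} (hm : m 0 ≠ 0) :
    coeff m φ = 0 := by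
  have h1 := coeff_X_mul_pd 0 φ m
  rw [h.pd_zero, mul_zero, map_zero] at h1
  exact (mul_eq_zero.1 h1.symm).resolve_left (Nat.cast_ne_zero.2 hm)

/-- Homogeneity is known for the third derivatives only, so it lifts to `φ` only in total degree at
least three. -/
theorem coeff_act (h : IsQuantumCorrection φ) {m : Fin (r + 1) →₀ ℕ} (hm : 3 ≤ m.degree) :
    coeff m (act (eulerField r) φ) = (3 - (r : ℂ)) * coeff m φ := by
  rw [← coeff_C_mul]
  refine third_eq_third_iff.1 ?_ m hm
  funext a b c
  have h1 := h.isQuantumTensor.homogeneous a b c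
  rw [third_add, third_classicalPart, act_add, act_C, zero_add, mul_add,
    C_mul_C_ite_eq_zero, zero_add] at h1
  rw [third_act_eulerField, h1, third_C_mul, ← add_mul, ← map_add C]
  congr 2
  ring

theorem recursion (hr : 2 ≤ r) (h : IsQuantumCorrection φ) {n : MultiIdx r} {d k : ℕ}
    (hd : HasDegree n d) (hk : 3 ≤ ∑ a, n a + k) :
    ((k : ℂ) + 1) * coeff (expo n (k + 1)) φ = d * coeff (expo n k) φ := by
  have h1 := h.coeff_act (m := expo n k) (by rwa [degree_expo])
  rw [coeff_act_eulerField, weight_expo hr, hd, expo_one hr, expo_add_single] at h1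
  push_cast at h1
  refine mul_left_cancel₀ (Nat.cast_add_one_ne_zero (R := ℂ) r) ?_
  linear_combination h1

theorem factorial_mul_coeff (hr : 2 ≤ r) (h : IsQuantumCorrection φ) {n : MultiIdx r} {d k : ℕ}
    (hd : HasDegree n d) (hk : 3 ≤ ∑ a, n a + k) (j : ℕ) :
    ((k + j).factorial : ℂ) * coeff (expo n (k + j)) φ =
      (d : ℂ) ^ j * (k.factorial * coeff (expo n k) φ) := by
  induction j with
  | zero => simp
  | succ j ih =>
    have := h.recursion hr hd (k := k + j) (by omega)
    rw [← add_assoc, Nat.factorial_succ, pow_succ']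
    push_cast at this ⊢
    linear_combination ((k + j).factorial : ℂ) * this + d * ih

theorem coeff_pd_one (hr : 2 ≤ r) (h : IsQuantumCorrection φ) (b c : Fin (r + 1)) :
    coeff (Finsupp.single b 1 + Finsupp.single c 1) (pd 1 φ) *
      (((Finsupp.single b 1 : Fin (r + 1) →₀ ℕ) c : ℂ) + 1) =
      if (b : ℕ) = r ∧ (c : ℕ) = r then 1 else 0 := by
  have h1 := h.isQuantumTensor.coeff_zero b c
  rw [third_add, third_classicalPart, map_add, coeff_zero_C, val_one_eq_one hr,
    coeff_zero_third_one] at h1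
  by_cases h2 : (b : ℕ) + c + 1 = r
  · rw [if_pos (by omega), if_pos (Or.inl h2)] at h1
    rw [if_neg (by omega)]
    exact add_eq_left.1 h1
  · rw [if_neg (by omega), zero_add] at h1
    simpa [h2] using h1

/-- The recursion with `d = 0` settles total degree above three; total degree three lies below its
range and is settled by the values at the origin. -/
theorem coeff_eq_zero_of_degree_zero (hr : 2 ≤ r) (h : IsQuantumCorrection φ) {n : MultiIdx r}
    {k : ℕ} (hd : HasDegree n 0) (hk : 3 ≤ ∑ a, n a + (k + 1)) :
    coeff (expo n (k + 1)) φ = 0 := by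
  by_cases hk' : 3 ≤ ∑ a, n a + k
  · have := h.recursion hr hd hk'
    rw [Nat.cast_zero, zero_mul] at this
    exact (mul_eq_zero.1 this).resolve_left (Nat.cast_add_one_ne_zero _)
  · have hdeg := degree_expo n k
    obtain ⟨c, m, h1, hm⟩ := exists_eq_add_single (k := 1) (m := expo n k) (by omega)
    obtain ⟨b, m', h2, hm'⟩ := exists_eq_add_single (k := 0) hm
    have h3 : m' = 0 := by
      rw [← Finsupp.degree_eq_zero_iff]
      rw [h1, h2, map_add, map_add, Finsupp.degree_single, Finsupp.degree_single] at hdeg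
      omega
    rw [h3, zero_add] at h2
    rw [h2] at h1
    have h4 := h.coeff_pd_one hr b c
    have h5 := weight_expo hr n k
    rw [hd, h1, weight_single_add_single] at h5
    -- Here `b + c = r - 1`, which excludes `b = c = r`.
    rw [if_neg (by push_cast at h5; omega)] at h4
    have h6 := (mul_eq_zero.1 h4).resolve_right (Nat.cast_add_one_ne_zero _)
    rw [← h1, pd, coeff_pderiv, expo_add_single] at h6
    exact (mul_eq_zero.1 h6).resolve_right (Nat.cast_add_one_ne_zero _)

end IsQuantumCorrection

/-! ### Reading the numbers off the quantum correction -/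

open Classical in
/-- The numbers `N(d; n)` read off from the coefficients of a formal series. -/
noncomputable def gwNumbers {r : ℕ} (φ : FormalFun r) (d : ℕ) (n : MultiIdx r) : ℂ :=
  if HasDegree n d then
    (∏ a, ((n a).factorial : ℂ)) *
      -- For `d ≠ 0` the coefficient at `(x^1)^3` is used, with `6 = 3!`, because coefficients of
      -- `φ` of total degree below three vanish and carry no information.
      if d = 0 then coeff (expo n 0) φ else 6 / (d : ℂ) ^ 3 * coeff (expo n 3) φ
  else 0

theorem dimensionConstraint_gwNumbers {r : ℕ} (φ : FormalFun r) :
    DimensionConstraint r (gwNumbers φ) := by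
  intro d n h
  by_contra h0
  exact h (if_neg h0)

theorem IsQuantumCorrection.coeff_eq {r : ℕ} (hr : 2 ≤ r) {φ : FormalFun r}
    (h : IsQuantumCorrection φ) {m : Fin (r + 1) →₀ ℕ} (hm : 3 ≤ m.degree) :
    coeff m (gwPart r (gwNumbers φ)) = coeff m φ := by
  have hN := dimensionConstraint_gwNumbers φ
  by_cases h0 : m 0 = 0
  · obtain ⟨n, k, rfl⟩ : ∃ n k, m = expo n k := ⟨_, _, eq_expo hr h0⟩
    rw [degree_expo] at hm
    have hP : (∏ a, ((n a).factorial : ℂ)) * ∏ a, ((n a).factorial : ℂ)⁻¹ = 1 := by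
      rw [← Finset.prod_mul_distrib]
      exact Finset.prod_eq_one fun a _ =>
        mul_inv_cancel₀ (Nat.cast_ne_zero.2 (Nat.factorial_ne_zero _))
    by_cases hd : ∃ d, HasDegree n d
    · obtain ⟨d, hd⟩ := hd
      rw [coeff_gwPart_of_hasDegree hr hN hd, gwNumbers, if_pos hd, mul_right_comm _ _ (∏ a, _),
        hP, one_mul]
      by_cases hd0 : d = 0
      · subst hd0
        cases k with
        | zero => simp
        | succ k => rw [h.coeff_eq_zero_of_degree_zero hr hd hm]; simp
      · have hdc : (d : ℂ) ≠ 0 := Nat.cast_ne_zero.2 hd0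
        have hkf : (k.factorial : ℂ) ≠ 0 := Nat.cast_ne_zero.2 (Nat.factorial_ne_zero _)
        -- The exponents `k` and `3` both lie in the range of the recursion, which is run upwards
        -- from the smaller to the larger.
        have key : 6 * coeff (expo n 3) φ * (d : ℂ) ^ k =
            (d : ℂ) ^ 3 * (k.factorial * coeff (expo n k) φ) := by
          have h6 : ((Nat.factorial 3 : ℕ) : ℂ) = 6 := by norm_num [Nat.factorial]
          rcases le_total k 3 with hk | hk
          · have := h.factorial_mul_coeff hr hd hm (3 - k)
            rw [Nat.add_sub_cancel' hk, h6] at this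
            rw [this, ← Nat.sub_add_cancel hk, pow_add]
            simp only [Nat.sub_add_cancel hk]
            ring
          · have := h.factorial_mul_coeff hr hd (k := 3) (by omega) (k - 3)
            rw [Nat.add_sub_cancel' hk, h6] at this
            rw [this, ← mul_assoc, ← pow_add, Nat.add_sub_cancel' hk]
            ring
        rw [if_neg hd0]
        field_simp
        linear_combination key
    · push Not at hd
      rw [coeff_gwPart_eq_zero hr hN hd]
      by_contra hne
      -- A nonzero coefficient has an integral degree by the cyclic symmetry, and since its weight
      -- is nonnegative this degree exceeds `-1`; so it would satisfy `HasDegree`.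
      obtain ⟨d, hdd⟩ := h.dvd _ (by rwa [degree_expo]) (Ne.symm hne)
      rw [weight_expo hr] at hdd
      have hw : 0 ≤ ∑ a, (((a.1 : ℕ) : ℤ) - 1) * (n a : ℤ) :=
        Finset.sum_nonneg fun a _ => mul_nonneg (by have := a.2; omega) (by omega)
      have hd1 : -1 < d := by
        by_contra hd1
        have : ((r : ℤ) + 1) * (d + 1) ≤ 0 :=
          mul_nonpos_of_nonneg_of_nonpos (by omega) (by omega)
        have e : ((r : ℤ) + 1) * (d + 1) = ((r : ℤ) + 1) * d + r + 1 := by ring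
        omega
      lift d to ℕ using by omega
      exact hd d (by rw [HasDegree]; linarith)
  · rw [coeff_gwPart_of_ne hr _ h0, h.coeff_of_ne h0]

theorem IsQuantumCorrection.isGWSolution {r : ℕ} (hr : 2 ≤ r) {φ : FormalFun r}
    (h : IsQuantumCorrection φ) : IsGWSolution r (gwNumbers φ) where
  dimension := dimensionConstraint_gwNumbers φ
  noLowDegree n hn := by
    rw [gwNumbers, if_pos rfl, h.mem, mul_zero, ite_self]
    rw [degree_expo]
    omega
  normalized := by
    have h1 := coeff_gwPart_of_hasDegree hr (dimensionConstraint_gwNumbers φ)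
      (hasDegree_twoPoints hr) 1
    rw [h.coeff_eq hr (by rw [expo_twoPoints hr]; simp), prod_factorial_twoPoints hr,
      expo_twoPoints hr] at h1
    have h2 := h.coeff_pd_one hr (Fin.last r) (Fin.last r)
    have hl : (1 : Fin (r + 1)) ≠ Fin.last r := by
      rw [Ne, Fin.ext_iff, val_one_eq_one hr, Fin.val_last]; omega
    rw [← Finsupp.single_add, pd, coeff_pderiv, h1] at h2
    simp [hl] at h2
    linear_combination h2
  wdvv := by
    have h1 : third (gwPart r (gwNumbers φ)) = third φ :=
      third_eq_third_iff.2 fun m hm => h.coeff_eq hr hm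
    have h2 : third (potential r (gwNumbers φ)) = third (classicalPart r + φ) := by
      funext a b c
      rw [potential, third_add, third_add, h1]
    rw [wdvv_iff, h2]
    exact h.isQuantumTensor.assoc

/-! ### The flat identity and the Euler field -/

theorem bracket_eulerField {r : ℕ} (W : VField r) (c : Fin (r + 1)) :
    bracket (eulerField r) W c = act (eulerField r) (W c) - C (1 - ((c : ℕ) : ℂ)) * W c := by
  rw [bracket]
  congr 1
  simp only [act, pd_eulerField, mul_ite, mul_zero, Finset.sum_ite_eq', Finset.mem_univ, if_true]
  exact mul_comm _ _

theorem circ_apply {r : ℕ} (Φ : FormalFun r) (V W : VField r) (c : Fin (r + 1)) :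
    circ Φ V W c = ∑ a, ∑ b, V a * W b * third Φ a b c.rev := by
  rw [circ]
  exact Finset.sum_congr rfl fun a _ => Finset.sum_congr rfl fun b _ => by
    rw [sum_mul_pairingInv fun e => third Φ a b e]

theorem circ_comm {r : ℕ} (Φ : FormalFun r) (V W : VField r) : circ Φ V W = circ Φ W V := by
  funext c
  rw [circ_apply, circ_apply, Finset.sum_comm]
  exact Finset.sum_congr rfl fun a _ => Finset.sum_congr rfl fun b _ => by
    rw [third_symm_left, mul_comm (V b)]

theorem isFlatIdentity {r : ℕ} {Φ : FormalFun r}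
    (h : ∀ b c, third Φ 0 b c = C (pairing r b c)) : IsFlatIdentity Φ (coordField 0) := by
  have key : ∀ V, circ Φ (coordField 0) V = V := by
    intro V
    funext c
    rw [circ_apply, Finset.sum_eq_single 0, Finset.sum_eq_single c]
    · rw [h, coordField, Pi.single_eq_same, one_mul, pairing, Matrix.of_apply, if_pos, map_one,
        mul_one]
      rw [Fin.val_rev]; omega
    · intro b _ hb
      rw [h, pairing, Matrix.of_apply, if_neg, map_zero, mul_zero]
      intro e
      apply hb
      ext
      rw [Fin.val_rev] at e
      omega
    · simp
    · intro a _ ha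
      simp [coordField, Pi.single_eq_of_ne ha]
    · simp
  refine ⟨fun a c => ?_, key, fun V => (circ_comm _ _ _).trans (key V)⟩
  rw [coordField, Pi.single_apply]
  split_ifs
  · exact pderiv_one
  · exact map_zero _

theorem isEulerField {r : ℕ} {Φ : FormalFun r}
    (h : ∀ a b c, act (eulerField r) (third Φ a b c) =
      C (((a : ℕ) : ℂ) + ((b : ℕ) : ℂ) + ((c : ℕ) : ℂ) - r) * third Φ a b c) :
    IsEulerField Φ 1 (eulerField r) where
  poisson V W := by
    rw [one_smul]
    funext c
    rw [poissonTensor, Pi.sub_apply, Pi.sub_apply, bracket_eulerField]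
    simp only [circ_apply, act_sum, Finset.mul_sum, ← Finset.sum_sub_distrib]
    refine Finset.sum_congr rfl fun a _ => Finset.sum_congr rfl fun b _ => ?_
    -- Termwise the weights add up to `(a + b - c) - (1 - c) + (1 - a) + (1 - b) = 1`.
    rw [act_mul, act_mul, h, bracket_eulerField, bracket_eulerField, cast_rev]
    simp only [map_sub, map_add, map_one]
    ring
  preserves_flat V hV a c := by
    have : act (eulerField r) (V c) = 0 :=
      Finset.sum_eq_zero fun b _ => by rw [hV b c, mul_zero]
    rw [bracket_eulerField, this, zero_sub, pd, map_neg, neg_eq_zero]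
    change pd a _ = 0
    rw [pd_C_mul, hV, mul_zero]

theorem lieMetric_eulerField {r : ℕ} (V W : VField r) :
    lieMetric (eulerField r) V W = C (2 - (r : ℂ)) * metric V W := by
  simp only [lieMetric, metric, act_sum, Finset.mul_sum, ← Finset.sum_sub_distrib]
  refine Finset.sum_congr rfl fun a _ => Finset.sum_congr rfl fun b _ => ?_
  rw [act_mul, act_mul, act_C, bracket_eulerField, bracket_eulerField, pairing, Matrix.of_apply]
  split_ifs with hab
  · have : (C (r : ℂ) : FormalFun r) = C ((a : ℕ) : ℂ) + C ((b : ℕ) : ℂ) := by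
      rw [← map_add]
      congr 1
      exact_mod_cast hab.symm
    have h2 : (C (2 : ℂ) : FormalFun r) = 1 + 1 := by
      rw [← map_one C, ← map_add]; norm_num
    simp only [map_sub, map_one, this, h2]
    ring
  · simp

end QuantumPr

theorem mainTheorem2 (r : ℕ) (hr : 2 ≤ r) :
    (∃! N : ℕ → QuantumPr.MultiIdx r → ℂ, QuantumPr.IsGWSolution r N) ∧
      ∀ N : ℕ → QuantumPr.MultiIdx r → ℂ, QuantumPr.IsGWSolution r N →
        QuantumPr.IsFlatIdentity (QuantumPr.potential r N) (QuantumPr.coordField 0) ∧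
        QuantumPr.IsEulerField (QuantumPr.potential r N) 1 (QuantumPr.eulerField r) ∧
        ∀ V W : QuantumPr.VField r,
          QuantumPr.lieMetric (QuantumPr.eulerField r) V W =
            MvPowerSeries.C (2 - (r : ℂ)) * QuantumPr.metric V W := by
  refine ⟨?_, fun N hN => ⟨?_, ?_, QuantumPr.lieMetric_eulerField⟩⟩
  · obtain ⟨φ, hφ⟩ := QuantumPr.exists_isQuantumCorrection hr
    exact ⟨_, hφ.isGWSolution hr, fun N hN => hN.unique hr (hφ.isGWSolution hr)⟩
  · exact QuantumPr.isFlatIdentity (QuantumPr.third_potential_zero hr N)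
  · exact QuantumPr.isEulerField (QuantumPr.third_potential_homogeneous hr hN.dimension)
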